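/- **Setting.** Let $G_1,\dots,G_r$ be a partition of $[n]$, let $M$ be an $m\times n$ matrix with non-negative real entries, let $y\in[0,1]^n$ satisfy $\sum_{j\in G_i}y_j=1$ for every $i$, and let $t\ge 1$ be an integer with $t\ge 12m$. For $W\subseteq[n]$ and $z\in[0,1]^n$ put $$Q(W,z)=\prod_{i=1}^r\Bigl(1-\sum_{j\in W\cap G_i}z_j\Bigr),\qquad T(z,i)=\max\bigl(0,|\{j\in G_i: z_j\notin\{0,1\}\}|-1\bigr),\qquad T(z)=\sum_{i=1}^rT(z,i).$$ **The algorithm $\mathrm{KPR}(G,M,y,t)$.** Start from the vector $y$. 1. For $i=1,\dots,r$ in turn, replace the current vector $z$ by a random vector $z'$ whose conditional expectation given the past is $z$ and which is almost surely an extreme point of the polytope $\{x\in[0,1]^n: Mx=Mz,\ \sum_{j\in G_i}x_j=1,\ x_j=z_j\text{ for }j\notin G_i\}$. 2. While the current vector $z$ has $T(z)>t$, do the following iteration. Form a random set $J\subseteq[r]$ that contains each $i\in[r]$ independently with probability $3m/T(z)$, given the past. If $\sum_{i\in J}T(z,i)\ge m+1$, choose (in an arbitrary, possibly randomized and history-dependent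 way) a vector $\delta\in\mathbb R^n$ such that $M\delta=0$; $z\pm\delta\in[0,1]^n$; $z_j+\delta_j\in\{0,1\}$ or $z_j-\delta_j\in\{0,1\}$ for at least one $j$ with $z_j\notin\{0,1\}$; $\delta_j=0$ whenever $j\in G_i$ with $i\notin J$; and $\sum_{j\in G_i}\delta_j=0$ for all $i$. Then replace $z$ by $z+\delta$ or $z-\delta$, with probability $1/2$ each, by a fair coin independent of everything before. If $\sum_{i\in J}T(z,i)\le m$, leave $z$ unchanged. 3. Return the current vector $y'$. **Theorem.** There is an absolute constant $C>0$ such that, for all data as above, every $W\subseteq[n]$, every real $b>2$ and $a=\dfrac{m^2\log^3 b}{t}$, every execution of $\mathrm{KPR}(G,M,y,t)$ terminates almost surely and its output $y'$ satisfies $$\mathbb E\,[Q(W,y')]\le e^{Ca}\Bigl(Q(W,y)+\frac ab\Bigr).$$ -/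

import Mathlib

open MeasureTheory ProbabilityTheory

namespace KPR

/-- `G 0, …, G (r-1)` is a partition of the ground set `[n]`. -/
def IsPartition {n r : ℕ} (G : Fin r → Finset (Fin n)) : Prop :=
  ∀ j : Fin n, ∃! i : Fin r, j ∈ G i

/-- The potential `Q(W, y) = ∏ i, (1 - y(W ∩ G i))`. -/
noncomputable def Q {n r : ℕ} (G : Fin r → Finset (Fin n)) (W : Finset (Fin n))
    (y : Fin n → ℝ) : ℝ :=
  ∏ i : Fin r, (1 - ∑ j ∈ W ∩ G i, y j)

/-- `frac(X, z)`: the entries of `X` at which `z` is fractional. -/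
noncomputable def frac {n : ℕ} (X : Finset (Fin n)) (z : Fin n → ℝ) : Finset (Fin n) :=
  X.filter fun j => z j ≠ 0 ∧ z j ≠ 1

/-- `T(z, i) = max(0, |frac(G i, z)| - 1)` (truncated subtraction of natural numbers). -/
noncomputable def blockT {n r : ℕ} (G : Fin r → Finset (Fin n)) (z : Fin n → ℝ)
    (i : Fin r) : ℕ :=
  (frac (G i) z).card - 1

/-- `T(z) = ∑ i, T(z, i)`. -/
noncomputable def totalT {n r : ℕ} (G : Fin r → Finset (Fin n)) (z : Fin n → ℝ) : ℕ :=
  ∑ i : Fin r, blockT G z i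

/-- The polytope of the vectors in `[0,1]^n` that agree with `z` off the block `G i`, have total
mass one on `G i`, and have the same knapsack values as `z`. -/
def blockPolytope {n r m : ℕ} (G : Fin r → Finset (Fin n)) (M : Matrix (Fin m) (Fin n) ℝ)
    (z : Fin n → ℝ) (i : Fin r) : Set (Fin n → ℝ) :=
  {x | (∀ j, x j ∈ Set.Icc (0 : ℝ) 1) ∧ M.mulVec x = M.mulVec z ∧ ∑ j ∈ G i, x j = 1 ∧
    ∀ j, j ∉ G i → x j = z j}

/-- One pass of the first loop (for the block `G i`): given the past `𝓕`, the current random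
vector `z` is replaced by a random vector `z'` with conditional mean `z`, which is an extreme point
of the polytope of `z` and `i`. -/
structure IsBlockReduction {n r m : ℕ} (G : Fin r → Finset (Fin n))
    (M : Matrix (Fin m) (Fin n) ℝ) {Ω : Type*} [MeasurableSpace Ω] (P : Measure Ω)
    (𝓕 : MeasurableSpace Ω) (i : Fin r) (z z' : Ω → Fin n → ℝ) : Prop where
  extreme : ∀ᵐ ω ∂P, z' ω ∈ (blockPolytope G M (z ω) i).extremePoints ℝ
  unbiased : ∀ j, P[fun ω => z' ω j | 𝓕] =ᵐ[P] fun ω => z ω j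

/-- The conditions on the modification vector `δ` for the current vector `y` and the selected
set `J` of blocks. -/
structure IsDirection {n r m : ℕ} (G : Fin r → Finset (Fin n)) (M : Matrix (Fin m) (Fin n) ℝ)
    (y : Fin n → ℝ) (J : Finset (Fin r)) (δ : Fin n → ℝ) : Prop where
  knapsack : M.mulVec δ = 0
  add_mem : ∀ j, y j + δ j ∈ Set.Icc (0 : ℝ) 1
  sub_mem : ∀ j, y j - δ j ∈ Set.Icc (0 : ℝ) 1
  progress : ∃ j ∈ frac Finset.univ y,
    y j + δ j ∈ ({0, 1} : Set ℝ) ∨ y j - δ j ∈ ({0, 1} : Set ℝ)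
  support : ∀ i, i ∉ J → ∀ j ∈ G i, δ j = 0
  block : ∀ i, ∑ j ∈ G i, δ j = 0

/-- On the event `E`, the random vector `y'` results from `y` by one KPR iteration.
`𝓕` is the past before the iteration, `J` the random set of blocks, `𝓗` the information (past,
`J`, and any auxiliary randomness) from which `δ` is chosen, and `H` the event that the final fair
coin selects `y + δ`. -/
structure IsIteration {n r m : ℕ} (G : Fin r → Finset (Fin n)) (M : Matrix (Fin m) (Fin n) ℝ)
    {Ω : Type*} [mΩ : MeasurableSpace Ω] (P : Measure Ω) (𝓕 𝓗 : MeasurableSpace Ω) (E : Set Ω)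
    (J : Ω → Finset (Fin r)) (δ : Ω → Fin n → ℝ) (H : Set Ω)
    (y y' : Ω → Fin n → ℝ) : Prop where
  past_le : 𝓕 ≤ 𝓗
  le_ambient : 𝓗 ≤ mΩ
  measurable_J : ∀ S : Finset (Fin r), MeasurableSet[𝓗] {ω | J ω = S}
  measurable_δ : Measurable[𝓗] δ
  measurable_H : MeasurableSet[mΩ] H
  /-- Given the past, each block goes into `J` independently with probability `3 m / T(y)`. -/
  law_J : ∀ S : Finset (Fin r), ∀ᵐ ω ∂P, ω ∈ E →
    (P⟦{ω' | J ω' = S} | 𝓕⟧) ω =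
      (3 * (m : ℝ) / totalT G (y ω)) ^ S.card *
        (1 - 3 * (m : ℝ) / totalT G (y ω)) ^ (r - S.card)
  /-- The coin is fair, given everything that happened before it is thrown. -/
  law_H : ∀ᵐ ω ∂P, ω ∈ E → (P⟦H | 𝓗⟧) ω = 1 / 2
  /-- If `J` is large enough, `δ` is admissible and `y'` is `y + δ` or `y - δ`, by the coin. -/
  move : ∀ᵐ ω ∂P, ω ∈ E → m + 1 ≤ ∑ i ∈ J ω, blockT G (y ω) i →
    IsDirection G M (y ω) (J ω) (δ ω) ∧
      (ω ∈ H → y' ω = y ω + δ ω) ∧ (ω ∉ H → y' ω = y ω - δ ω)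
  /-- If `J` is too small, nothing changes. -/
  stay : ∀ᵐ ω ∂P, ω ∈ E → ¬ m + 1 ≤ ∑ i ∈ J ω, blockT G (y ω) i → y' ω = y ω

/-- An execution of `KPR(G, M, y, t)` on a probability space. `x k` is the value of the vector
after `k` steps: step `i < r` treats the block `G i` in the first loop, and each later step
is a round of the loop "while `T > t`, apply a KPR iteration". The past `𝓕` may contain extra
randomness, and all choices the algorithm leaves open are arbitrary functions of it. -/
structure Run {n r m : ℕ} (G : Fin r → Finset (Fin n)) (M : Matrix (Fin m) (Fin n) ℝ)
    (y : Fin n → ℝ) (t : ℕ) {Ω : Type*} [mΩ : MeasurableSpace Ω] (P : Measure Ω) where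
  x : ℕ → Ω → Fin n → ℝ
  𝓕 : Filtration ℕ mΩ
  adapted : ∀ k, Measurable[𝓕 k] (x k)
  start : ∀ ω, x 0 ω = y
  reduce : ∀ i : Fin r, IsBlockReduction G M P (𝓕 i) i (x i) (x (i + 1))
  𝓗 : ℕ → MeasurableSpace Ω
  J : ℕ → Ω → Finset (Fin r)
  δ : ℕ → Ω → Fin n → ℝ
  H : ℕ → Set Ω
  iterate : ∀ k, r ≤ k → IsIteration G M P (𝓕 k) (𝓗 k) {ω | t < totalT G (x k ω)}
    (J k) (δ k) (H k) (x k) (x (k + 1))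
  halt : ∀ k, r ≤ k → ∀ᵐ ω ∂P, totalT G (x k ω) ≤ t → x (k + 1) ω = x k ω

/-- The loop of the execution is left after finitely many rounds. -/
def Run.Terminates {n r m : ℕ} {G : Fin r → Finset (Fin n)} {M : Matrix (Fin m) (Fin n) ℝ}
    {y : Fin n → ℝ} {t : ℕ} {Ω : Type*} [MeasurableSpace Ω] {P : Measure Ω}
    (R : Run G M y t P) (ω : Ω) : Prop :=
  ∃ k, r ≤ k ∧ totalT G (R.x k ω) ≤ t

open Classical in
/-- The vector returned by the execution: the value of `x` when the loop is left (and the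
irrelevant value `0` if that never happens). -/
noncomputable def Run.output {n r m : ℕ} {G : Fin r → Finset (Fin n)}
    {M : Matrix (Fin m) (Fin n) ℝ} {y : Fin n → ℝ} {t : ℕ} {Ω : Type*} [MeasurableSpace Ω]
    {P : Measure Ω} (R : Run G M y t P) (ω : Ω) : Fin n → ℝ :=
  if h : R.Terminates ω then R.x (Nat.find h) ω else 0

end KPR

namespace KPR

/-! The first loop preserves `E[Q]`: `Q` is affine in the entries of a single block, and each pass
is conditionally unbiased. It also leaves at most `m + 1` fractional entries per block
(`blockT_le_of_extreme`), so `T(z, i) ≤ m` throughout the second loop.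

In the second loop the potential `Q * exp (-A / max T t) - B / max T t` is a supermartingale. Put `v
i = min 1 (2 y(W ∩ G i))`, `s = ∑ v i`, `p = 3m/T`. An admissible `δ` changes the factor of block
`i` by a relative amount of at most `v i`, and only for `i ∈ J`. The fair coin cancels odd-order
terms, and averaging over `J` gives mean growth of `Q` by at most `cosh (p s)`. Against this, `J` is
heavy enough to move with probability at least `1/4` (`sum_light_le`), and then one of the two coin
outcomes lowers `T`. Two cases are balanced in `growth_le_drop`. If `s ≤ 128 log b`, then `cosh (p
s) - 1` is of order `(m log b / T)^2`, and the drop of the exponential factor pays. If `s` is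
larger, `Q ≤ exp (-s/2)` is so small that its growth is at most of order `m^2 / (T^2 b^16)`, and the
additive term pays. Since `1/(T-1) - 1/T ≥ 1/T^2`, both payments have the required order.

The potential starts below `Q(W, y)` in mean, and its coefficients are controlled by `A / t` and `B
/ t`, whence `Run.integral_Q_le`. This argument needs `t ≥ 3072 m log b`; for smaller `t` the
claimed bound already exceeds `1`. Termination holds because the mean of `T` loses at least `1/8`
times the probability of still running in every round. -/

/-! ### Products, random subsets and elementary exponential estimates -/

/-- The even part of `∏ (x i + d i)` is dominated by its value at the extreme `d i = x i * v i`. A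
new factor mixes even and odd parts, so the induction must carry the bound on the odd part as well.
-/
theorem prod_add_prod_sub_le {ι : Type*} (s : Finset ι) (x d v : ι → ℝ)
    (hx : ∀ i, 0 ≤ x i) (hv : ∀ i, v i ∈ Set.Icc (0 : ℝ) 1) (hd : ∀ i, |d i| ≤ x i * v i) :
    ∏ i ∈ s, (x i + d i) + ∏ i ∈ s, (x i - d i) ≤
        (∏ i ∈ s, x i) * (∏ i ∈ s, (1 + v i) + ∏ i ∈ s, (1 - v i)) ∧
      |∏ i ∈ s, (x i + d i) - ∏ i ∈ s, (x i - d i)| ≤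
        (∏ i ∈ s, x i) * (∏ i ∈ s, (1 + v i) - ∏ i ∈ s, (1 - v i)) := by
  classical
  have hdx : ∀ i, |d i| ≤ x i := fun i =>
    (hd i).trans (mul_le_of_le_one_right (hx i) (hv i).2)
  induction s using Finset.induction_on with
  | empty => simp
  | insert i s hi ih =>
    have hA : 0 ≤ ∏ i ∈ s, (x i + d i) :=
      Finset.prod_nonneg fun i _ => by linarith [(abs_le.1 (hdx i)).1]
    have hB : 0 ≤ ∏ i ∈ s, (x i - d i) :=
      Finset.prod_nonneg fun i _ => by linarith [(abs_le.1 (hdx i)).2]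
    simp only [Finset.prod_insert hi]
    revert ih hA hB
    generalize ∏ i ∈ s, (x i + d i) = A
    generalize ∏ i ∈ s, (x i - d i) = B
    generalize ∏ i ∈ s, x i = X
    generalize ∏ i ∈ s, (1 + v i) = U
    generalize ∏ i ∈ s, (1 - v i) = V
    rintro ⟨h1, h2⟩ hA hB
    have hxi := hx i
    have hvi := (hv i).1
    have hxv : 0 ≤ x i * v i := mul_nonneg hxi hvi
    have k1 : |d i * (A - B)| ≤ (x i * v i) * (X * (U - V)) := by
      rw [abs_mul]; exact mul_le_mul (hd i) h2 (abs_nonneg _) hxv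
    have k2 : |d i * (A + B)| ≤ (x i * v i) * (X * (U + V)) := by
      rw [abs_mul, abs_of_nonneg (add_nonneg hA hB)]
      exact mul_le_mul (hd i) h1 (add_nonneg hA hB) hxv
    have k3 : x i * (A + B) ≤ x i * (X * (U + V)) := mul_le_mul_of_nonneg_left h1 hxi
    have k4 : |x i * (A - B)| ≤ x i * (X * (U - V)) := by
      rw [abs_mul, abs_of_nonneg hxi]; exact mul_le_mul_of_nonneg_left h2 hxi
    constructor
    · linarith [(abs_le.1 k1).2]
    · rw [abs_le] at k2 k4 ⊢
      constructor <;> linarith [k2.1, k2.2, k4.1, k4.2]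

/-- This is the expectation of a product over a random set with independent memberships, obtained by
expanding `∏ (p * c i + (1 - p))`. -/
theorem sum_pow_mul_prod {r : ℕ} (p : ℝ) (c : Fin r → ℝ) :
    ∑ S : Finset (Fin r), p ^ S.card * (1 - p) ^ (r - S.card) * ∏ i ∈ S, c i =
      ∏ i, (1 + p * (c i - 1)) := by
  have h := Finset.prod_add (fun i => p * c i) (fun _ => 1 - p) (Finset.univ : Finset (Fin r))
  rw [Finset.powerset_univ] at h
  rw [show ∏ i, (1 + p * (c i - 1)) = ∏ i, (p * c i + (1 - p)) from
    Finset.prod_congr rfl fun i _ => by ring, h]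
  refine Finset.sum_congr rfl fun S _ => ?_
  rw [Finset.prod_mul_distrib, Finset.prod_const, Finset.prod_const,
    Finset.card_sdiff_of_subset (Finset.subset_univ S), Finset.card_univ, Fintype.card_fin]
  ring

theorem sum_pow_eq_one {r : ℕ} (p : ℝ) :
    ∑ S : Finset (Fin r), p ^ S.card * (1 - p) ^ (r - S.card) = 1 := by
  simpa using sum_pow_mul_prod (r := r) p (fun _ => 1)

theorem one_sub_sum_le_prod {ι : Type*} (s : Finset ι) (c : ι → ℝ)
    (hc : ∀ i, c i ∈ Set.Icc (0 : ℝ) 1) : 1 - ∑ i ∈ s, c i ≤ ∏ i ∈ s, (1 - c i) := by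
  classical
  induction s using Finset.induction_on with
  | empty => simp
  | insert i s hi ih =>
    rw [Finset.sum_insert hi, Finset.prod_insert hi]
    have h1 : ∏ i ∈ s, (1 - c i) ≤ 1 :=
      Finset.prod_le_one (fun i _ => by linarith [(hc i).2]) fun i _ => by linarith [(hc i).1]
    nlinarith [(hc i).1, (hc i).2]

/-- A random set of blocks in which the expected weight is `3 m` has weight at most `m` with
probability at most `3 / 4`, if no block weighs more than `m`. -/
theorem sum_light_le {r m : ℕ} (hm : 0 < m) (τ : Fin r → ℕ) (hτ : ∀ i, τ i ≤ m) (p : ℝ)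
    (hp : p ∈ Set.Icc (0 : ℝ) 1) (hpT : p * ∑ i, (τ i : ℝ) = 3 * m) :
    ∑ S : Finset (Fin r), (if m + 1 ≤ ∑ i ∈ S, τ i then 0 else
      p ^ S.card * (1 - p) ^ (r - S.card)) ≤ 3 / 4 := by
  have hm' : (0 : ℝ) < m := by exact_mod_cast hm
  -- With this scaling a set of weight at most `m` has `∑ c ≤ 1/2`, hence `∏ (1 - c i) ≥ 1/2`. So
  -- twice that product dominates the indicator of a light set, and its mean is at most `2 * exp
  -- (-3/2)`.
  set c : Fin r → ℝ := fun i => τ i / (2 * m) with hc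
  have hc01 : ∀ i, c i ∈ Set.Icc (0 : ℝ) 1 := fun i => by
    refine ⟨by positivity, ?_⟩
    rw [hc]; simp only
    rw [div_le_one (by positivity)]
    have : (τ i : ℝ) ≤ m := by exact_mod_cast hτ i
    linarith
  have key : ∑ S : Finset (Fin r), (if m + 1 ≤ ∑ i ∈ S, τ i then 0 else
      p ^ S.card * (1 - p) ^ (r - S.card)) ≤
      ∑ S : Finset (Fin r), 2 * (p ^ S.card * (1 - p) ^ (r - S.card) * ∏ i ∈ S, (1 - c i)) := by
    refine Finset.sum_le_sum fun S _ => ?_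
    have hw : 0 ≤ p ^ S.card * (1 - p) ^ (r - S.card) :=
      mul_nonneg (pow_nonneg hp.1 _) (pow_nonneg (by linarith [hp.2]) _)
    have hpr : 0 ≤ ∏ i ∈ S, (1 - c i) :=
      Finset.prod_nonneg fun i _ => by linarith [(hc01 i).2]
    split_ifs with h
    · positivity
    · have h1 := one_sub_sum_le_prod S c hc01
      have h2 : ∑ i ∈ S, c i ≤ 1 / 2 := by
        rw [hc, ← Finset.sum_div, div_le_iff₀ (by positivity)]
        have : ((∑ i ∈ S, τ i : ℕ) : ℝ) ≤ m := by exact_mod_cast (by omega)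
        push_cast at this
        linarith
      nlinarith
  refine key.trans ?_
  rw [← Finset.mul_sum, sum_pow_mul_prod]
  have h3 : ∏ i, (1 + p * (1 - c i - 1)) ≤ Real.exp (-(3 / 2)) := by
    calc ∏ i, (1 + p * (1 - c i - 1)) ≤ ∏ i, Real.exp (-(p * c i)) := by
          refine Finset.prod_le_prod (fun i _ => ?_) fun i _ => ?_
          · nlinarith [(hc01 i).1, (hc01 i).2, hp.1, hp.2]
          · have := Real.add_one_le_exp (-(p * c i)); linarith
      _ = Real.exp (-(3 / 2)) := by
          rw [← Real.exp_sum]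
          congr 1
          rw [Finset.sum_neg_distrib, ← Finset.mul_sum, hc, ← Finset.sum_div, ← mul_div_assoc, hpT]
          field_simp
  have h4 := Real.quadratic_le_exp_of_nonneg (show (0 : ℝ) ≤ 3 / 2 by norm_num)
  have h5 : Real.exp (-(3 / 2)) * Real.exp (3 / 2) = 1 := by rw [← Real.exp_add]; simp
  nlinarith [Real.exp_pos (-(3 / 2 : ℝ))]

/-- Exactly, `cosh x - 1 = (1 - exp (-x))^2 * exp x / 2`. -/
theorem cosh_sub_one_le {x : ℝ} (hx : 0 ≤ x) : Real.cosh x - 1 ≤ x ^ 2 / 2 * Real.exp x := by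
  have h1 : 1 - x ≤ Real.exp (-x) := by linarith [Real.add_one_le_exp (-x)]
  have h2 : Real.exp (-x) * Real.exp x = 1 := by rw [← Real.exp_add]; simp
  have h3 : Real.exp (-x) ≤ 1 := Real.exp_le_one_iff.2 (by linarith)
  rw [Real.cosh_eq]
  have he := Real.exp_pos x
  have h4 : (1 - Real.exp (-x)) ^ 2 ≤ x ^ 2 := by
    apply pow_le_pow_left₀ <;> linarith
  nlinarith [mul_le_mul_of_nonneg_right h4 he.le]

theorem one_sub_exp_neg_ge {x : ℝ} (hx : 0 ≤ x) (hx1 : x ≤ 1) :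
    x / 2 ≤ 1 - Real.exp (-x) := by
  have h1 := Real.add_one_le_exp x
  have h2 : Real.exp (-x) * Real.exp x = 1 := by rw [← Real.exp_add]; simp
  nlinarith [Real.exp_pos (-x)]

/-! ### One-step drift of the potential -/

/-- The inverse of the potential `T`, cut off at the halting threshold. -/
noncomputable def invT (t T : ℕ) : ℝ := 1 / (max T t : ℕ)

theorem invT_nonneg (t T : ℕ) : 0 ≤ invT t T := by unfold invT; positivity

theorem invT_anti {t : ℕ} (ht : 0 < t) {T T' : ℕ} (h : T' ≤ T) : invT t T ≤ invT t T' := by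
  unfold invT
  have : 0 < max T' t := lt_max_of_lt_right ht
  have h2 : max T' t ≤ max T t := max_le_max_right t h
  gcongr

theorem invT_le {t : ℕ} (ht : 0 < t) (T : ℕ) : invT t T ≤ 1 / t := by
  have h2 : t ≤ max T t := le_max_right _ _
  unfold invT
  gcongr

/-- While the loop runs, `T - 1 ≥ t`, so the cutoff is inactive at both arguments and the difference
is `1 / (T (T - 1))`. -/
theorem invT_pred_sub {t T : ℕ} (ht : 0 < t) (hT : t < T) :
    1 / (T : ℝ) ^ 2 ≤ invT t (T - 1) - invT t T := by
  unfold invT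
  rw [max_eq_left (by omega), max_eq_left (by omega), Nat.cast_sub (by omega)]
  have h1 : (1 : ℝ) < T := by exact_mod_cast (by omega : 1 < T)
  have h2 : (0 : ℝ) < T - 1 := by linarith
  rw [Nat.cast_one, div_sub_div _ _ h2.ne' (by positivity),
    div_le_div_iff₀ (by positivity) (by positivity)]
  nlinarith

/-- Upper bound for the mean of the potential `q * exp (-A * invT T) - B * invT T` after an
iteration with the set `S` of blocks. -/
noncomputable def moveBound {r : ℕ} (m t : ℕ) (A B q : ℝ) (v : Fin r → ℝ) (τ : Fin r → ℕ)
    (S : Finset (Fin r)) : ℝ :=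
  q * Real.exp (-A * invT t (∑ i, τ i)) *
      ((∏ i ∈ S, (1 + v i) + ∏ i ∈ S, (1 - v i)) / 2) - B * invT t (∑ i, τ i) -
    if m + 1 ≤ ∑ i ∈ S, τ i then
      q * ((Real.exp (-A * invT t (∑ i, τ i)) - Real.exp (-A * invT t (∑ i, τ i - 1))) / 2) *
          ∏ i ∈ S, (1 - v i) +
        B * ((invT t (∑ i, τ i - 1) - invT t (∑ i, τ i)) / 2)
    else 0

theorem cosh_sub_one_le_sq {x : ℝ} (hx : 0 ≤ x) (hx1 : x ≤ 1 / 2) :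
    Real.cosh x - 1 ≤ x ^ 2 := by
  have h2 : Real.exp x ≤ 2 := by
    have h4 : Real.exp (-x) * Real.exp x = 1 := by rw [← Real.exp_add]; simp
    have h5 := Real.add_one_le_exp (-x)
    nlinarith [Real.exp_pos x]
  nlinarith [sq_nonneg x, cosh_sub_one_le hx]

/-- The decay `exp (-s/2)` of `q` beats the growth `exp (p s) ≤ exp (s/4)`. Half of the remaining
`exp (-s/4)` absorbs the factor `s^2`. -/
theorem mul_cosh_sub_one_le_exp {q p s : ℝ} (hq0 : 0 ≤ q) (hs0 : 0 ≤ s)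
    (hq : q ≤ Real.exp (-s / 2)) (hp0 : 0 ≤ p) (hp4 : p ≤ 1 / 4) :
    q * (Real.cosh (p * s) - 1) ≤ 64 * p ^ 2 * Real.exp (-(s / 8)) := by
  have hcosh := cosh_sub_one_le (mul_nonneg hp0 hs0)
  have e1 : Real.exp (p * s) ≤ Real.exp (s / 4) := Real.exp_le_exp.2 (by nlinarith)
  have e2 : s ^ 2 / 128 ≤ Real.exp (s / 8) := by
    have := Real.quadratic_le_exp_of_nonneg (show 0 ≤ s / 8 by linarith)
    nlinarith
  calc q * (Real.cosh (p * s) - 1) ≤ q * ((p * s) ^ 2 / 2 * Real.exp (p * s)) := by gcongr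
    _ ≤ Real.exp (-s / 2) * ((p * s) ^ 2 / 2 * Real.exp (s / 4)) := by gcongr
    _ = 64 * p ^ 2 * (s ^ 2 / 128) * (Real.exp (-s / 2) * Real.exp (s / 4)) := by ring
    _ ≤ 64 * p ^ 2 * Real.exp (s / 8) * (Real.exp (-s / 2) * Real.exp (s / 4)) := by gcongr
    _ = 64 * p ^ 2 * Real.exp (-(s / 8)) := by
      rw [mul_assoc, ← Real.exp_add, ← Real.exp_add]; congr 2; ring

/-- The loss of the potential at level `T` outweighs the growth of `q`. -/
theorem growth_le_drop {m t T : ℕ} {b q p s N R A B : ℝ} (ht : 0 < t) (hmt : 12 * m ≤ t)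
    (hb : 2 < b) (htb : 3072 * m * Real.log b ≤ t) (hT : t < T)
    (hq0 : 0 ≤ q) (hs0 : 0 ≤ s) (hq : q ≤ Real.exp (-s / 2)) (hp : p = 3 * (m : ℝ) / T)
    (hA : A = 4718592 * (m : ℝ) ^ 2 * Real.log b ^ 2) (hB : B = 4608 * (m : ℝ) ^ 2 / b ^ 16)
    (hNn : 0 ≤ N) (hN : 1 / 4 - p * s ≤ N) (hlarge : 1 / 4 ≤ R) :
    q * Real.exp (-A * invT t T) * (Real.cosh (p * s) - 1) ≤
      q * ((Real.exp (-A * invT t T) - Real.exp (-A * invT t (T - 1))) / 2) * N +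
        B * ((invT t (T - 1) - invT t T) / 2) * R := by
  have hlb : 0 < Real.log b := Real.log_pos (by linarith)
  have hAn : 0 ≤ A := by rw [hA]; positivity
  have hBn : 0 ≤ B := by rw [hB]; positivity
  have hΔ := invT_pred_sub ht hT
  have hanti := invT_anti ht (Nat.sub_le T 1)
  have hTt : (t : ℝ) < T := by exact_mod_cast hT
  have hmt' : 12 * (m : ℝ) ≤ t := by exact_mod_cast hmt
  have hm' : (0 : ℝ) ≤ m := m.cast_nonneg
  have hT0 : (0 : ℝ) < T := by linarith
  have hp0 : 0 ≤ p := by rw [hp]; positivity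
  have hp4 : p ≤ 1 / 4 := by
    rw [hp, div_le_iff₀ hT0]; linarith
  have hpT : p * T = 3 * m := by rw [hp]; field_simp
  have hf0 : 0 < Real.exp (-A * invT t T) := Real.exp_pos _
  have hf1 : Real.exp (-A * invT t T) ≤ 1 := Real.exp_le_one_iff.2 (by nlinarith [invT_nonneg t T])
  have hff : Real.exp (-A * invT t (T - 1)) ≤ Real.exp (-A * invT t T) :=
    Real.exp_le_exp.2 (by nlinarith)
  set f := Real.exp (-A * invT t T) with hf
  set f' := Real.exp (-A * invT t (T - 1)) with hf'
  set h := invT t T with hh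
  set h' := invT t (T - 1) with hh'
  have hps0 : 0 ≤ p * s := mul_nonneg hp0 hs0
  rcases le_or_gt s (128 * Real.log b) with hsmall | hbig
  · -- the drop of `f` pays for the growth
    have hps : p * s ≤ 384 * m * Real.log b / T := by
      have := mul_le_mul_of_nonneg_left hsmall hp0
      rw [le_div_iff₀ hT0]
      calc p * s * T ≤ p * (128 * Real.log b) * T := by gcongr
        _ = (p * T) * (128 * Real.log b) := by ring
        _ = _ := by rw [hpT]; ring
    -- `u` is the value of `p * s` at the threshold `s = 128 log b`, since `p * T = 3 m`. The
    -- hypothesis with `3072 = 8 * 384` gives `u ≤ 1/8`. `A` is chosen so that `A / T^2 = 32 u^2`: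
    -- the factor `exp` then drops by at least `16 u^2` relatively, and the coin's `1/2` and `N ≥
    -- 1/8` leave exactly the `u^2` needed.
    set u := 384 * m * Real.log b / T with hu
    have hu8 : u ≤ 1 / 8 := by
      rw [hu, div_le_iff₀ hT0]; linarith
    have hu0 : 0 ≤ u := hps0.trans hps
    have hu64 : u ^ 2 ≤ 1 / 64 := by
      refine (pow_le_pow_left₀ hu0 hu8 2).trans (le_of_eq ?_); norm_num
    have hAu : A / T ^ 2 = 32 * u ^ 2 := by
      rw [hA, hu]; field_simp; ring
    have hc : Real.cosh (p * s) - 1 ≤ u ^ 2 :=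
      (cosh_sub_one_le_sq hps0 (by linarith)).trans (pow_le_pow_left₀ hps0 hps 2)
    have hdrop : f * (16 * u ^ 2) ≤ f - f' := by
      have h6 : f' ≤ f * Real.exp (-(32 * u ^ 2)) := by
        rw [hf, hf', ← Real.exp_add]
        apply Real.exp_le_exp.2
        rw [← hAu]
        have := mul_le_mul_of_nonneg_left hΔ hAn
        rw [mul_one_div] at this
        linarith
      have h7 := one_sub_exp_neg_ge (x := 32 * u ^ 2) (by positivity) (by linarith [hu64])
      have h8 := mul_le_mul_of_nonneg_left h7 hf0.le
      linarith
    have hN8 : 1 / 8 ≤ N := by linarith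
    have h8 : 0 ≤ B * ((h' - h) / 2) * R := by
      apply mul_nonneg (mul_nonneg hBn (by linarith)); linarith
    have h9 : f * (Real.cosh (p * s) - 1) ≤ (f - f') / 2 * N := by
      have h10 : f * (Real.cosh (p * s) - 1) ≤ f * u ^ 2 := mul_le_mul_of_nonneg_left hc hf0.le
      have h11 : f * (16 * u ^ 2) / 2 * (1 / 8) ≤ (f - f') / 2 * N := by
        apply mul_le_mul _ hN8 (by norm_num) (by linarith)
        linarith
      linarith
    refine le_trans (le_of_eq (mul_assoc _ _ _)) ?_
    refine le_trans (mul_le_mul_of_nonneg_left h9 hq0) ?_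
    rw [← mul_assoc]
    exact le_add_of_nonneg_right h8
  · -- the drop of the additive term pays for the growth
    have h1 := mul_cosh_sub_one_le_exp hq0 hs0 hq hp0 hp4
    have h2 : Real.exp (-(s / 8)) ≤ 1 / b ^ 16 := by
      have : Real.exp (-(s / 8)) ≤ Real.exp (-(16 * Real.log b)) :=
        Real.exp_le_exp.2 (by linarith)
      refine this.trans (le_of_eq ?_)
      rw [Real.exp_neg, one_div, show (16 : ℝ) = (16 : ℕ) by norm_num, Real.exp_nat_mul,
        Real.exp_log (by linarith)]
    -- `B` is chosen for equality here: `64 p^2 = 576 m^2 / T^2` and `4608 = 8 * 576`. The `8` is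
    -- the coin's `1/2` times the heavy probability `1/4`.
    have h3 : q * (Real.cosh (p * s) - 1) ≤ B / (8 * T ^ 2) := by
      refine h1.trans ?_
      calc 64 * p ^ 2 * Real.exp (-(s / 8)) ≤ 64 * p ^ 2 * (1 / b ^ 16) := by gcongr
        _ = B / (8 * T ^ 2) := by
          rw [hB, hp]; field_simp; ring
    have h4 : 0 ≤ q * ((f - f') / 2) * N :=
      mul_nonneg (mul_nonneg hq0 (by linarith)) hNn
    have h5 : B / (8 * T ^ 2) ≤ B * ((h' - h) / 2) * R := by
      calc B / (8 * T ^ 2) = B * (1 / T ^ 2 / 2) * (1 / 4) := by field_simp; ring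
        _ ≤ _ := by
          have : 0 ≤ h' - h := by linarith
          gcongr
    have h6 : q * f * (Real.cosh (p * s) - 1) ≤ q * (Real.cosh (p * s) - 1) := by
      rw [mul_right_comm]
      exact mul_le_of_le_one_right
        (mul_nonneg hq0 (sub_nonneg.2 (Real.one_le_cosh (p * s)))) hf1
    exact h6.trans (h3.trans (h5.trans (le_add_of_nonneg_left h4)))

/-- By independence the two products have means `∏ (1 ± p * v i)`, at most `exp (± p * ∑ v i)`. -/
theorem sum_even_part_le_cosh {r : ℕ} {p : ℝ} (v : Fin r → ℝ)
    (hv : ∀ i, v i ∈ Set.Icc (0 : ℝ) 1) (hp0 : 0 ≤ p) (hp1 : p ≤ 1) :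
    ∑ S : Finset (Fin r), p ^ S.card * (1 - p) ^ (r - S.card) *
      ((∏ i ∈ S, (1 + v i) + ∏ i ∈ S, (1 - v i)) / 2) ≤ Real.cosh (p * ∑ i, v i) := by
  set w : Finset (Fin r) → ℝ := fun S => p ^ S.card * (1 - p) ^ (r - S.card) with hw
  have e1 : ∑ S, w S * ((∏ i ∈ S, (1 + v i) + ∏ i ∈ S, (1 - v i)) / 2) =
      (∑ S, w S * ∏ i ∈ S, (1 + v i) + ∑ S, w S * ∏ i ∈ S, (1 - v i)) / 2 := by
    rw [← Finset.sum_add_distrib, Finset.sum_div]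
    exact Finset.sum_congr rfl fun S _ => by ring
  rw [e1, hw, sum_pow_mul_prod, sum_pow_mul_prod, Real.cosh_eq]
  have e2 : ∏ i, (1 + p * (1 + v i - 1)) ≤ Real.exp (p * ∑ i, v i) := by
    rw [Finset.mul_sum, Real.exp_sum]
    refine Finset.prod_le_prod (fun i _ => ?_) fun i _ => ?_
    · nlinarith [(hv i).1]
    · linarith [Real.add_one_le_exp (p * v i)]
  have e3 : ∏ i, (1 + p * (1 - v i - 1)) ≤ Real.exp (-(p * ∑ i, v i)) := by
    rw [Finset.mul_sum, ← Finset.sum_neg_distrib, Real.exp_sum]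
    refine Finset.prod_le_prod (fun i _ => ?_) fun i _ => ?_
    · nlinarith [(hv i).1, (hv i).2]
    · linarith [Real.add_one_le_exp (-(p * v i))]
  linarith

theorem sum_moveBound_le {r m t : ℕ} {b q p : ℝ} (ht : 0 < t) (hmt : 12 * m ≤ t)
    (hb : 2 < b) (htb : 3072 * m * Real.log b ≤ t) (v : Fin r → ℝ) (τ : Fin r → ℕ)
    (hv : ∀ i, v i ∈ Set.Icc (0 : ℝ) 1) (hτ : ∀ i, τ i ≤ m) (hT : t < ∑ i, τ i)
    (hq0 : 0 ≤ q) (hq : q ≤ Real.exp (-(∑ i, v i) / 2))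
    (hp : p = 3 * (m : ℝ) / (∑ i, τ i : ℕ)) {A B : ℝ}
    (hA : A = 4718592 * (m : ℝ) ^ 2 * Real.log b ^ 2) (hB : B = 4608 * (m : ℝ) ^ 2 / b ^ 16) :
    ∑ S : Finset (Fin r), p ^ S.card * (1 - p) ^ (r - S.card) * moveBound m t A B q v τ S ≤
      q * Real.exp (-A * invT t (∑ i, τ i)) - B * invT t (∑ i, τ i) := by
  have hm : 0 < m := by
    rcases Nat.eq_zero_or_pos m with rfl | h
    · have : ∑ i, τ i = 0 := Finset.sum_eq_zero fun i _ => Nat.le_zero.1 (hτ i)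
      omega
    · exact h
  have hsumT : ∑ i, (τ i : ℝ) = ((∑ i, τ i : ℕ) : ℝ) := by push_cast; rfl
  set w : Finset (Fin r) → ℝ := fun S => p ^ S.card * (1 - p) ^ (r - S.card) with hw
  unfold moveBound
  generalize hTdef : ∑ i, τ i = T at *
  have hTt : (t : ℝ) < T := by exact_mod_cast hT
  have hmt' : 12 * (m : ℝ) ≤ t := by exact_mod_cast hmt
  have hm' : (0 : ℝ) < m := by exact_mod_cast hm
  have hT0 : (0 : ℝ) < T := by linarith
  have hp0 : 0 ≤ p := by rw [hp]; positivity
  have hp4 : p ≤ 1 / 4 := by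
    rw [hp, div_le_iff₀ hT0]; linarith
  have hpT : p * T = 3 * m := by rw [hp]; field_simp
  set f := Real.exp (-A * invT t T) with hf
  set f' := Real.exp (-A * invT t (T - 1)) with hf'
  set h := invT t T with hh
  set h' := invT t (T - 1) with hh'
  have hf0 : 0 < f := Real.exp_pos _
  have hw0 : ∀ S, 0 ≤ w S := fun S =>
    mul_nonneg (pow_nonneg hp0 _) (pow_nonneg (by linarith) _)
  set s := ∑ i, v i with hs
  have hs0 : 0 ≤ s := Finset.sum_nonneg fun i _ => (hv i).1
  have hlight := sum_light_le hm τ hτ p ⟨hp0, by linarith⟩ (by rw [hsumT, hpT])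
  -- the mean of the even part
  have hD := sum_even_part_le_cosh v hv hp0 (by linarith)
  have hone : ∑ S, w S = 1 := sum_pow_eq_one p
  have hsplit : ∀ g : Finset (Fin r) → ℝ,
      ∑ S, w S * g S = (∑ S, if m + 1 ≤ ∑ i ∈ S, τ i then w S * g S else 0) +
        ∑ S, if m + 1 ≤ ∑ i ∈ S, τ i then 0 else w S * g S := fun g => by
    rw [← Finset.sum_add_distrib]
    exact Finset.sum_congr rfl fun S _ => by split_ifs <;> simp
  have hlarge : 1 / 4 ≤ ∑ S, if m + 1 ≤ ∑ i ∈ S, τ i then w S else 0 := by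
    have := hsplit fun _ => 1
    simp only [mul_one] at this
    linarith
  have hN0 : ∀ S : Finset (Fin r), 0 ≤ ∏ i ∈ S, (1 - v i) := fun S =>
    Finset.prod_nonneg fun i _ => by linarith [(hv i).2]
  have hN1 : ∀ S : Finset (Fin r), ∏ i ∈ S, (1 - v i) ≤ 1 := fun S =>
    Finset.prod_le_one (fun i _ => by linarith [(hv i).2]) fun i _ => by linarith [(hv i).1]
  -- Over all sets the mean of `∏ (1 - v i)` is at least `1 - p s`; light sets contribute at most
  -- their probability `3/4`.
  have hN : 1 / 4 - p * s ≤
      ∑ S, if m + 1 ≤ ∑ i ∈ S, τ i then w S * ∏ i ∈ S, (1 - v i) else 0 := by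
    have h1 := hsplit fun S => ∏ i ∈ S, (1 - v i)
    have h2 : (∑ S, if m + 1 ≤ ∑ i ∈ S, τ i then 0 else w S * ∏ i ∈ S, (1 - v i)) ≤ 3 / 4 := by
      refine le_trans (Finset.sum_le_sum fun S _ => ?_) hlight
      split_ifs
      · exact le_rfl
      · exact mul_le_of_le_one_right (hw0 S) (hN1 S)
    have h3 : 1 - p * s ≤ ∑ S, w S * ∏ i ∈ S, (1 - v i) := by
      rw [hw, sum_pow_mul_prod]
      have h4 := one_sub_sum_le_prod Finset.univ (fun i => p * v i) fun i =>
        ⟨mul_nonneg hp0 (hv i).1, by nlinarith [(hv i).1, (hv i).2]⟩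
      rw [← Finset.mul_sum] at h4
      refine h4.trans (le_of_eq (Finset.prod_congr rfl fun i _ => by ring))
    linarith
  set N := ∑ S, if m + 1 ≤ ∑ i ∈ S, τ i then w S * ∏ i ∈ S, (1 - v i) else 0 with hNdef
  set D := ∑ S, w S * ((∏ i ∈ S, (1 + v i) + ∏ i ∈ S, (1 - v i)) / 2) with hDdef
  set R := ∑ S, if m + 1 ≤ ∑ i ∈ S, τ i then w S else 0 with hR
  have hNn : 0 ≤ N := Finset.sum_nonneg fun S _ => by
    split_ifs
    · exact mul_nonneg (hw0 S) (hN0 S)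
    · exact le_rfl
  have hexp : ∑ S, w S * (q * f * ((∏ i ∈ S, (1 + v i) + ∏ i ∈ S, (1 - v i)) / 2) - B * h -
      if m + 1 ≤ ∑ i ∈ S, τ i then q * ((f - f') / 2) * ∏ i ∈ S, (1 - v i) + B * ((h' - h) / 2)
      else 0) = q * f * D - B * h - q * ((f - f') / 2) * N - B * ((h' - h) / 2) * R := by
    have e : q * f * D - B * h - q * ((f - f') / 2) * N - B * ((h' - h) / 2) * R =
        q * f * D - ∑ S, w S * (B * h) - q * ((f - f') / 2) * N - B * ((h' - h) / 2) * R := by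
      rw [← Finset.sum_mul, hone, one_mul]
    rw [e, hNdef, hDdef, hR]
    simp only [Finset.mul_sum, ← Finset.sum_sub_distrib]
    refine Finset.sum_congr rfl fun S _ => ?_
    split_ifs <;> ring
  rw [hexp]
  suffices hmain : q * f * (Real.cosh (p * s) - 1) ≤
      q * ((f - f') / 2) * N + B * ((h' - h) / 2) * R by
    have := mul_le_mul_of_nonneg_left hD (mul_nonneg hq0 hf0.le)
    linarith
  exact growth_le_drop ht hmt hb htb hT hq0 hs0 hq hp hA hB hNn hN hlarge

/-! ### Feasible vectors, admissible directions and block polytopes -/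

section Combinatorics

variable {n r m : ℕ} {G : Fin r → Finset (Fin n)} {M : Matrix (Fin m) (Fin n) ℝ}
  {W : Finset (Fin n)} {y δ : Fin n → ℝ} {J : Finset (Fin r)}

/-- The vectors of the unit cube with total mass one on every block. -/
structure Feasible (G : Fin r → Finset (Fin n)) (y : Fin n → ℝ) : Prop where
  mem : ∀ j, y j ∈ Set.Icc (0 : ℝ) 1
  block : ∀ i, ∑ j ∈ G i, y j = 1

/-- The mass `y(W ∩ G i)`. -/
noncomputable def mass (G : Fin r → Finset (Fin n)) (W : Finset (Fin n)) (y : Fin n → ℝ)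
    (i : Fin r) : ℝ :=
  ∑ j ∈ W ∩ G i, y j

/-- A bound for the possible relative change of the factor `1 - y(W ∩ G i)` of `Q`. -/
noncomputable def rate (G : Fin r → Finset (Fin n)) (W : Finset (Fin n)) (y : Fin n → ℝ)
    (i : Fin r) : ℝ :=
  min 1 (2 * mass G W y i)

theorem Q_eq : Q G W y = ∏ i, (1 - mass G W y i) := rfl

theorem Feasible.mass_mem (h : Feasible G y) (i : Fin r) : mass G W y i ∈ Set.Icc (0 : ℝ) 1 := by
  refine ⟨Finset.sum_nonneg fun j _ => (h.mem j).1, ?_⟩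
  rw [← h.block i]
  exact Finset.sum_le_sum_of_subset_of_nonneg Finset.inter_subset_right fun j _ _ => (h.mem j).1

theorem Feasible.Q_nonneg (h : Feasible G y) : 0 ≤ Q G W y :=
  Finset.prod_nonneg fun i _ => sub_nonneg.2 (h.mass_mem i).2

theorem Feasible.Q_le_one (h : Feasible G y) : Q G W y ≤ 1 :=
  Finset.prod_le_one (fun i _ => sub_nonneg.2 (h.mass_mem i).2) fun i _ =>
    sub_le_self _ (h.mass_mem (W := W) i).1

theorem Feasible.rate_mem (h : Feasible G y) (i : Fin r) : rate G W y i ∈ Set.Icc (0 : ℝ) 1 :=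
  ⟨le_min zero_le_one (mul_nonneg zero_le_two (h.mass_mem i).1), min_le_left _ _⟩

/-- Factorwise, `1 - x ≤ exp (-x)` and the rate is at most twice the mass. -/
theorem Feasible.Q_le_exp (h : Feasible G y) :
    Q G W y ≤ Real.exp (-(∑ i, rate G W y i) / 2) := by
  rw [← Finset.sum_neg_distrib, Finset.sum_div, Real.exp_sum]
  refine Finset.prod_le_prod (fun i _ => sub_nonneg.2 (h.mass_mem i).2) fun i _ => ?_
  have h1 := Real.add_one_le_exp (-rate G W y i / 2)
  have h2 : rate G W y i ≤ 2 * mass G W y i := min_le_right _ _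
  have h3 : mass G W y i = ∑ j ∈ W ∩ G i, y j := rfl
  linarith

theorem mass_add : mass G W (y + δ) = mass G W y + mass G W δ := by
  funext i; simp [mass, Finset.sum_add_distrib]

theorem mass_sub : mass G W (y - δ) = mass G W y - mass G W δ := by
  funext i; simp [mass, Finset.sum_sub_distrib]

theorem IsDirection.feasible_add (h : IsDirection G M y J δ) (hy : Feasible G y) :
    Feasible G (y + δ) :=
  ⟨h.add_mem, fun i => by simp [Finset.sum_add_distrib, h.block i, hy.block i]⟩

theorem IsDirection.feasible_sub (h : IsDirection G M y J δ) (hy : Feasible G y) :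
    Feasible G (y - δ) :=
  ⟨h.sub_mem, fun i => by simp [Finset.sum_sub_distrib, h.block i, hy.block i]⟩

theorem IsDirection.abs_mass_le (h : IsDirection G M y J δ) (hy : Feasible G y) (i : Fin r) :
    |mass G W δ i| ≤ (1 - mass G W y i) * (if i ∈ J then rate G W y i else 0) := by
  split_ifs with hi
  · have h1 := (h.feasible_add hy).mass_mem (W := W) i
    have h2 := (h.feasible_sub hy).mass_mem (W := W) i
    rw [mass_add] at h1
    rw [mass_sub] at h2
    simp only [Pi.add_apply, Pi.sub_apply, Set.mem_Icc] at h1 h2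
    have h0 := hy.mass_mem (W := W) i
    rw [abs_le, rate]
    -- Feasibility of both `y ± δ` bounds the change by the mass and by one minus the mass. The
    -- latter suffices when the mass is at least `1/2`; otherwise the former does, because `1 - mass
    -- ≥ 1/2`.
    rcases le_total 1 (2 * mass G W y i) with h3 | h3
    · rw [min_eq_left h3]
      constructor <;> linarith
    · rw [min_eq_right h3]
      have := mul_nonneg h0.1 (sub_nonneg.2 h3)
      constructor <;> nlinarith
  · rw [mul_zero, abs_nonpos_iff]
    exact Finset.sum_eq_zero fun j hj => h.support i hi j (Finset.mem_inter.1 hj).2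

theorem IsDirection.Q_add_Q_le (h : IsDirection G M y J δ) (hy : Feasible G y) :
    Q G W (y + δ) + Q G W (y - δ) ≤
      Q G W y * (∏ i ∈ J, (1 + rate G W y i) + ∏ i ∈ J, (1 - rate G W y i)) := by
  have key := (prod_add_prod_sub_le Finset.univ (fun i => 1 - mass G W y i)
    (fun i => mass G W δ i) (fun i => if i ∈ J then rate G W y i else 0)
    (fun i => sub_nonneg.2 (hy.mass_mem i).2)
    (fun i => by split_ifs; exacts [hy.rate_mem i, ⟨le_rfl, zero_le_one⟩])
    (fun i => h.abs_mass_le hy i)).1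
  have e1 : ∀ i, (1 + if i ∈ J then rate G W y i else 0) =
      if i ∈ J then 1 + rate G W y i else 1 := fun i => by split_ifs <;> simp
  have e2 : ∀ i, (1 - if i ∈ J then rate G W y i else 0) =
      if i ∈ J then 1 - rate G W y i else 1 := fun i => by split_ifs <;> simp
  simp only [e1, e2, Finset.prod_ite_mem, Finset.univ_inter] at key
  rw [Q_eq, Q_eq, Q_eq, mass_add, mass_sub, add_comm]
  simp only [Pi.add_apply, Pi.sub_apply]
  refine le_trans (le_of_eq ?_) key
  congr 1 <;> exact Finset.prod_congr rfl fun i _ => by ring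

/-- Which of `y + δ` and `y - δ` lowers `T` is unknown, so the profit from the drop needs a lower
bound on `Q` valid for both signs. -/
theorem mul_prod_le_Q (hy : Feasible G y) {e : Fin r → ℝ}
    (he : ∀ i, |e i| ≤ (1 - mass G W y i) * (if i ∈ J then rate G W y i else 0)) :
    Q G W y * ∏ i ∈ J, (1 - rate G W y i) ≤ ∏ i, (1 - mass G W y i - e i) := by
  have e2 : ∏ i ∈ J, (1 - rate G W y i) =
      ∏ i, (1 - if i ∈ J then rate G W y i else 0) := by
    rw [← Finset.univ_inter J, ← Finset.prod_ite_mem, Finset.univ_inter]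
    exact Finset.prod_congr rfl fun i _ => by split_ifs <;> simp
  rw [Q_eq, e2, ← Finset.prod_mul_distrib]
  refine Finset.prod_le_prod (fun i _ => ?_) fun i _ => ?_
  · refine mul_nonneg (sub_nonneg.2 (hy.mass_mem i).2) ?_
    split_ifs
    · exact sub_nonneg.2 (hy.rate_mem i).2
    · simp
  · have := (abs_le.1 (he i)).2
    rw [mul_sub, mul_one]
    linarith

theorem IsDirection.mul_prod_le_Q_add (h : IsDirection G M y J δ) (hy : Feasible G y) :
    Q G W y * ∏ i ∈ J, (1 - rate G W y i) ≤ Q G W (y + δ) := by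
  refine (mul_prod_le_Q hy (h.abs_mass_le hy)).trans (le_of_eq ?_)
  rw [Q_eq, mass_add]
  exact Finset.prod_congr rfl fun i _ => by simp only [Pi.add_apply]; ring

theorem IsDirection.mul_prod_le_Q_sub (h : IsDirection G M y J δ) (hy : Feasible G y) :
    Q G W y * ∏ i ∈ J, (1 - rate G W y i) ≤ Q G W (y - δ) := by
  refine (mul_prod_le_Q hy (e := fun i => -mass G W δ i)
    fun i => by rw [abs_neg]; exact h.abs_mass_le hy i).trans (le_of_eq ?_)
  rw [Q_eq, mass_sub]
  exact Finset.prod_congr rfl fun i _ => by simp only [Pi.sub_apply]; ring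

theorem IsDirection.neg (h : IsDirection G M y J δ) : IsDirection G M y J (-δ) where
  knapsack := by rw [Matrix.mulVec_neg, h.knapsack, neg_zero]
  add_mem j := by simpa [sub_eq_add_neg] using h.sub_mem j
  sub_mem j := by simpa using h.add_mem j
  progress := by
    obtain ⟨j, hj, h'⟩ := h.progress
    exact ⟨j, hj, by simpa [sub_eq_add_neg] using h'.symm⟩
  support i hi j hj := by simp [h.support i hi j hj]
  block i := by simp [h.block i]

theorem mem_frac {X : Finset (Fin n)} {j : Fin n} :
    j ∈ frac X y ↔ j ∈ X ∧ y j ≠ 0 ∧ y j ≠ 1 := by simp [frac]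

/-- An entry at `0` or `1` cannot move, since both signs must stay in the unit interval. -/
theorem IsDirection.frac_add_subset (h : IsDirection G M y J δ) (X : Finset (Fin n)) :
    frac X (y + δ) ⊆ frac X y := by
  intro j hj
  rw [mem_frac] at hj ⊢
  have h1 := h.add_mem j
  have h2 := h.sub_mem j
  refine ⟨hj.1, fun h0 => hj.2.1 ?_, fun h0 => hj.2.2 ?_⟩ <;>
  · rw [h0] at h1 h2
    simp only [Set.mem_Icc, Pi.add_apply] at *
    linarith [h1.1, h1.2, h2.1, h2.2]

theorem IsDirection.blockT_add_le (h : IsDirection G M y J δ) (i : Fin r) :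
    blockT G (y + δ) i ≤ blockT G y i :=
  Nat.sub_le_sub_right (Finset.card_le_card (h.frac_add_subset (G i))) 1

theorem IsDirection.totalT_add_le (h : IsDirection G M y J δ) :
    totalT G (y + δ) ≤ totalT G y :=
  Finset.sum_le_sum fun i _ => h.blockT_add_le i

/-- A block with a fractional entry has at least two of them. -/
theorem Feasible.two_le_card_frac (hy : Feasible G y) {i : Fin r} {j : Fin n}
    (hj : j ∈ frac (G i) y) : 2 ≤ (frac (G i) y).card := by
  by_contra hlt
  have hone : (frac (G i) y).card = 1 := by
    have := Finset.card_pos.2 ⟨j, hj⟩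
    omega
  obtain ⟨j', hj'⟩ := Finset.card_eq_one.1 hone
  have hjj : j = j' := by rw [hj'] at hj; exact Finset.mem_singleton.1 hj
  subst hjj
  rw [mem_frac] at hj
  have hother : ∀ k ∈ (G i).erase j, y k = 0 ∨ y k = 1 := fun k hk => by
    by_contra hcon
    push Not at hcon
    have : k ∈ frac (G i) y := mem_frac.2 ⟨Finset.mem_of_mem_erase hk, hcon⟩
    rw [hj', Finset.mem_singleton] at this
    exact Finset.ne_of_mem_erase hk this
  have hsum := Finset.add_sum_erase (G i) y hj.1
  rw [hy.block i] at hsum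
  by_cases hex : ∃ k ∈ (G i).erase j, y k = 1
  · obtain ⟨k, hk, hk1⟩ := hex
    have := Finset.single_le_sum (f := y) (fun l _ => (hy.mem l).1) hk
    exact hj.2.1 (by linarith [(hy.mem j).1])
  · push Not at hex
    have : ∑ k ∈ (G i).erase j, y k = 0 :=
      Finset.sum_eq_zero fun k hk => (hother k hk).resolve_right (hex k hk)
    exact hj.2.2 (by linarith)

theorem IsDirection.totalT_add_lt (hG : IsPartition G) (h : IsDirection G M y J δ)
    (hy : Feasible G y) {j : Fin n} (hj : j ∈ frac Finset.univ y)
    (hint : y j + δ j ∈ ({0, 1} : Set ℝ)) : totalT G (y + δ) < totalT G y := by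
  obtain ⟨i, hi, -⟩ := hG j
  have hji : j ∈ frac (G i) y := mem_frac.2 ⟨hi, (mem_frac.1 hj).2⟩
  refine Finset.sum_lt_sum (fun i _ => h.blockT_add_le i) ⟨i, Finset.mem_univ i, ?_⟩
  have hlt : (frac (G i) (y + δ)).card < (frac (G i) y).card := by
    refine Finset.card_lt_card (Finset.ssubset_iff_subset_ne.2 ⟨h.frac_add_subset _, fun he => ?_⟩)
    rw [← he, mem_frac] at hji
    rcases hint with h0 | h0
    · exact hji.2.1 h0
    · exact hji.2.2 h0
  -- With at least two fractional entries beforehand, the truncated subtraction in `blockT` still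
  -- records the loss of one.
  have := hy.two_le_card_frac hji
  unfold blockT
  omega

theorem IsDirection.totalT_lt (hG : IsPartition G) (h : IsDirection G M y J δ)
    (hy : Feasible G y) :
    totalT G (y + δ) < totalT G y ∨ totalT G (y - δ) < totalT G y := by
  obtain ⟨j, hj, h1 | h1⟩ := h.progress
  · exact Or.inl (h.totalT_add_lt hG hy hj h1)
  · right
    rw [sub_eq_add_neg]
    exact h.neg.totalT_add_lt hG hy hj (by simpa [sub_eq_add_neg] using h1)

theorem IsDirection.totalT_sub_le (h : IsDirection G M y J δ) :
    totalT G (y - δ) ≤ totalT G y := by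
  rw [sub_eq_add_neg]; exact h.neg.totalT_add_le

theorem IsDirection.blockT_sub_le (h : IsDirection G M y J δ) (i : Fin r) :
    blockT G (y - δ) i ≤ blockT G y i := by
  rw [sub_eq_add_neg]; exact h.neg.blockT_add_le i

/-- The potential whose expectation does not increase during the iterations. -/
noncomputable def potential (G : Fin r → Finset (Fin n)) (W : Finset (Fin n)) (t : ℕ) (A B : ℝ)
    (y : Fin n → ℝ) : ℝ :=
  Q G W y * Real.exp (-A * invT t (totalT G y)) - B * invT t (totalT G y)

/-- Index `1` is the coin outcome on which `T` decreases. Only that one is credited with a drop; the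
other uses monotonicity alone. -/
theorem potential_add_le {t T T₁ T₂ : ℕ} (ht : 0 < t) {A B q₁ q₂ a b : ℝ} (hA : 0 ≤ A)
    (hB : 0 ≤ B) (h1 : a ≤ q₁) (ha : 0 ≤ a) (h2 : 0 ≤ q₂) (h12 : q₁ + q₂ ≤ b) (hT₁ : T₁ < T)
    (hT₂ : T₂ ≤ T) :
    (q₁ * Real.exp (-A * invT t T₁) - B * invT t T₁) +
        (q₂ * Real.exp (-A * invT t T₂) - B * invT t T₂) ≤
      b * Real.exp (-A * invT t T) - 2 * (B * invT t T) -
        (a * (Real.exp (-A * invT t T) - Real.exp (-A * invT t (T - 1))) +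
          B * (invT t (T - 1) - invT t T)) := by
  have i1 : invT t (T - 1) ≤ invT t T₁ := invT_anti ht (by omega)
  have i2 : invT t T ≤ invT t T₂ := invT_anti ht hT₂
  have i3 : invT t T ≤ invT t (T - 1) := invT_anti ht (by omega)
  have emono : ∀ u v : ℝ, u ≤ v → Real.exp (-A * v) ≤ Real.exp (-A * u) := fun u v huv =>
    Real.exp_le_exp.2 (by nlinarith)
  have e1 := emono _ _ i1
  have e2 := emono _ _ i2
  have e3 := emono _ _ i3
  have e0 : 0 ≤ Real.exp (-A * invT t T) := (Real.exp_pos _).le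
  have b1 := mul_le_mul_of_nonneg_left i1 hB
  have b2 := mul_le_mul_of_nonneg_left i2 hB
  have c1 := mul_le_mul_of_nonneg_left e1 (ha.trans h1)
  have c2 := mul_le_mul_of_nonneg_left e2 h2
  have c3 := mul_le_mul_of_nonneg_right h12 e0
  have c4 := mul_le_mul_of_nonneg_right h1 (sub_nonneg.2 e3)
  linarith

theorem IsDirection.potential_mean_le {t : ℕ} (hG : IsPartition G) (ht : 0 < t) {A B : ℝ}
    (hA : 0 ≤ A) (hB : 0 ≤ B) (h : IsDirection G M y J δ) (hy : Feasible G y)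
    (hJ : m + 1 ≤ ∑ i ∈ J, blockT G y i) :
    (potential G W t A B (y + δ) + potential G W t A B (y - δ)) / 2 ≤
      moveBound m t A B (Q G W y) (rate G W y) (blockT G y) J := by
  have hq := h.Q_add_Q_le (W := W) hy
  have h1 := h.mul_prod_le_Q_add (W := W) hy
  have h2 := h.mul_prod_le_Q_sub (W := W) hy
  have h0 : 0 ≤ Q G W y * ∏ i ∈ J, (1 - rate G W y i) :=
    mul_nonneg hy.Q_nonneg (Finset.prod_nonneg fun i _ => sub_nonneg.2 (hy.rate_mem i).2)
  unfold moveBound potential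
  rw [if_pos hJ]
  change _ ≤ _ * Real.exp (-A * invT t (totalT G y)) * _ - B * invT t (totalT G y) - (_ *
    ((Real.exp (-A * invT t (totalT G y)) - Real.exp (-A * invT t (totalT G y - 1))) / 2) * _ +
      B * ((invT t (totalT G y - 1) - invT t (totalT G y)) / 2))
  rcases h.totalT_lt hG hy with hlt | hlt
  · have := potential_add_le ht hA hB h1 h0 (h.feasible_sub hy).Q_nonneg hq hlt h.totalT_sub_le
    linarith
  · rw [add_comm] at hq
    have := potential_add_le ht hA hB h2 h0 (h.feasible_add hy).Q_nonneg hq hlt h.totalT_add_le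
    linarith

/-- Without a move nothing changes, and the even part of `∏ (1 + v i)` is at least `1`. -/
theorem potential_le_moveBound {t : ℕ} {A B : ℝ} (hy : Feasible G y)
    (hJ : ¬ m + 1 ≤ ∑ i ∈ J, blockT G y i) :
    potential G W t A B y ≤
      moveBound m t A B (Q G W y) (rate G W y) (blockT G y) J := by
  have key := (prod_add_prod_sub_le J (fun _ => 1) (fun _ => 0) (rate G W y)
    (fun _ => zero_le_one) (fun i => hy.rate_mem i)
    (fun i => by simpa using (hy.rate_mem i).1)).1
  simp only [add_zero, sub_zero, Finset.prod_const_one, one_mul] at key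
  unfold moveBound potential
  rw [if_neg hJ, sub_zero]
  refine sub_le_sub_right (le_mul_of_one_le_right ?_ (by linarith)) _
  exact mul_nonneg hy.Q_nonneg (Real.exp_pos _).le

theorem totalT_le (G : Fin r → Finset (Fin n)) (y : Fin n → ℝ) : totalT G y ≤ r * n := by
  calc totalT G y ≤ ∑ _i : Fin r, n := Finset.sum_le_sum fun i _ =>
        (Nat.sub_le _ _).trans ((Finset.card_le_univ _).trans (by simp))
    _ = r * n := by simp

theorem blockT_congr {z z' : Fin n → ℝ} {i : Fin r} (h : ∀ j ∈ G i, z j = z' j) :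
    blockT G z i = blockT G z' i := by
  unfold blockT frac
  rw [Finset.filter_congr fun j hj => by rw [h j hj]]

theorem IsPartition.not_mem (hG : IsPartition G) {i i' : Fin r} (hne : i' ≠ i) {j : Fin n}
    (hj : j ∈ G i') : j ∉ G i := fun hji => hne ((hG j).unique hj hji)

theorem blockT_congr_of_mem_blockPolytope (hG : IsPartition G) {z x : Fin n → ℝ} {i i' : Fin r}
    (hx : x ∈ blockPolytope G M z i) (hne : i' ≠ i) : blockT G x i' = blockT G z i' :=
  blockT_congr fun j hj => hx.2.2.2 j (hG.not_mem hne hj)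

theorem Feasible.of_mem_blockPolytope (hG : IsPartition G) (hy : Feasible G y) {i : Fin r}
    {x : Fin n → ℝ} (hx : x ∈ blockPolytope G M y i) : Feasible G x := by
  obtain ⟨h1, -, h3, h4⟩ := hx
  refine ⟨h1, fun i' => ?_⟩
  by_cases hii : i' = i
  · rw [hii, h3]
  · rw [← hy.block i']
    exact Finset.sum_congr rfl fun j hj => h4 j (hG.not_mem hii hj)

/-- An extreme point of the polytope of a block has at most `m + 1` fractional entries there. -/
theorem blockT_le_of_extreme {i : Fin r} {x : Fin n → ℝ}
    (hx : x ∈ (blockPolytope G M y i).extremePoints ℝ) : blockT G x i ≤ m := by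
  by_contra hlt
  set F := frac (G i) x with hF
  have hcard : m + 2 ≤ F.card := by
    rw [blockT, ← hF] at hlt; omega
  have hFn : F.card ≤ n := by simpa using F.card_le_univ
  obtain ⟨⟨h1, h2, h3, h4⟩, hext⟩ := mem_extremePoints.1 hx
  -- The target has dimension `m + 1 + (n - |F|) < n`, so some nonzero `d` supported on `F`
  -- preserves all equations. A small multiple of it can be added and subtracted, contradicting
  -- extremality.
  let Φ : (Fin n → ℝ) →ₗ[ℝ] (Fin m → ℝ) × ℝ × (↥(Fᶜ) → ℝ) :=
    (M.mulVecLin).prod ((∑ j ∈ G i, LinearMap.proj j).prod (LinearMap.funLeft ℝ ℝ Subtype.val))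
  have hker : LinearMap.ker Φ ≠ ⊥ := LinearMap.ker_ne_bot_of_finrank_lt (by
    simp only [Module.finrank_prod, Module.finrank_fintype_fun_eq_card, Fintype.card_fin,
      Module.finrank_self, Fintype.card_coe, Finset.card_compl]
    omega)
  obtain ⟨d, hd, hd0⟩ := Submodule.exists_mem_ne_zero_of_ne_bot hker
  have hd' : Φ d = 0 := hd
  have hM : M.mulVec d = 0 := congrArg Prod.fst hd'
  have hs : ∑ j ∈ G i, d j = 0 := by
    have := congrArg (fun q => q.2.1) hd'
    simpa [Φ, LinearMap.sum_apply] using this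
  have hoff : (fun j : ↥(Fᶜ) => d j) = 0 := congrArg (fun q => q.2.2) hd'
  have hoff' : ∀ j, j ∉ F → d j = 0 := fun j hj =>
    congrFun hoff ⟨j, Finset.mem_compl.2 hj⟩
  obtain ⟨ε, hε, hεd⟩ : ∃ ε : ℝ, 0 < ε ∧ ∀ j,
      x j + ε * d j ∈ Set.Icc (0 : ℝ) 1 ∧ x j - ε * d j ∈ Set.Icc (0 : ℝ) 1 := by
    have hev : ∀ᶠ ε in nhdsWithin (0 : ℝ) (Set.Ioi 0), ∀ j,
        x j + ε * d j ∈ Set.Icc (0 : ℝ) 1 ∧ x j - ε * d j ∈ Set.Icc (0 : ℝ) 1 := by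
      rw [Filter.eventually_all]
      intro j
      apply Filter.Eventually.filter_mono nhdsWithin_le_nhds
      by_cases hj : j ∈ F
      · have hj' := (mem_frac.1 hj).2
        have hpos : x j ∈ Set.Ioo (0 : ℝ) 1 :=
          ⟨lt_of_le_of_ne (h1 j).1 hj'.1.symm, lt_of_le_of_ne (h1 j).2 hj'.2⟩
        have c1 : Filter.Tendsto (fun ε : ℝ => x j + ε * d j) (nhds 0) (nhds (x j)) :=
          Continuous.tendsto' (by fun_prop) _ _ (by simp)
        have c2 : Filter.Tendsto (fun ε : ℝ => x j - ε * d j) (nhds 0) (nhds (x j)) :=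
          Continuous.tendsto' (by fun_prop) _ _ (by simp)
        filter_upwards [c1 (Ioo_mem_nhds hpos.1 hpos.2), c2 (Ioo_mem_nhds hpos.1 hpos.2)]
          with ε e1 e2
        exact ⟨Set.Ioo_subset_Icc_self e1, Set.Ioo_subset_Icc_self e2⟩
      · simp [hoff' j hj, (h1 j).1, (h1 j).2]
    obtain ⟨ε, h5, h6⟩ := (hev.and self_mem_nhdsWithin).exists
    exact ⟨ε, h6, h5⟩
  have hoffG : ∀ j, j ∉ G i → d j = 0 := fun j hj => hoff' j fun h => hj (mem_frac.1 h).1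
  have hplus : x + ε • d ∈ blockPolytope G M y i := by
    refine ⟨fun j => (hεd j).1, ?_, ?_, fun j hj => ?_⟩
    · rw [Matrix.mulVec_add, Matrix.mulVec_smul, hM, h2, smul_zero, add_zero]
    · simp [Finset.sum_add_distrib, ← Finset.mul_sum, hs, h3]
    · simp [hoffG j hj, h4 j hj]
  have hminus : x - ε • d ∈ blockPolytope G M y i := by
    refine ⟨fun j => (hεd j).2, ?_, ?_, fun j hj => ?_⟩
    · rw [Matrix.mulVec_sub, Matrix.mulVec_smul, hM, h2, smul_zero, sub_zero]
    · simp [Finset.sum_sub_distrib, ← Finset.mul_sum, hs, h3]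
    · simp [hoffG j hj, h4 j hj]
  have hseg : x ∈ openSegment ℝ (x + ε • d) (x - ε • d) := by
    refine ⟨1 / 2, 1 / 2, by norm_num, by norm_num, by norm_num, ?_⟩
    funext j
    simp only [Pi.add_apply, Pi.smul_apply, Pi.sub_apply, smul_eq_mul]
    ring
  have hfix := (hext _ hplus _ hminus hseg).1
  have : ε • d = 0 := by simpa using hfix
  exact hd0 ((smul_eq_zero.1 this).resolve_left hε.ne')

theorem measurable_blockT (G : Fin r → Finset (Fin n)) (i : Fin r) :
    Measurable fun y : Fin n → ℝ => blockT G y i := by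
  have h : Measurable fun y : Fin n → ℝ => (frac (G i) y).card := by
    unfold frac
    simp only [Finset.card_filter]
    refine Finset.measurable_sum _ fun j _ => Measurable.ite ?_ measurable_const measurable_const
    have e : {y : Fin n → ℝ | y j ≠ 0 ∧ y j ≠ 1} = (fun y : Fin n → ℝ => y j) ⁻¹' {0, 1}ᶜ := by
      ext y; simp
    rw [e]
    exact measurable_pi_apply j ((Set.toFinite _).measurableSet.compl)
  exact (measurable_from_top (f := fun k : ℕ => k - 1)).comp h

theorem measurable_totalT (G : Fin r → Finset (Fin n)) :
    Measurable fun y : Fin n → ℝ => totalT G y :=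
  Finset.measurable_sum _ fun i _ => measurable_blockT G i

theorem measurable_mass (G : Fin r → Finset (Fin n)) (W : Finset (Fin n)) (i : Fin r) :
    Measurable fun y : Fin n → ℝ => mass G W y i := by
  unfold mass; fun_prop

theorem measurable_Q (G : Fin r → Finset (Fin n)) (W : Finset (Fin n)) :
    Measurable fun y : Fin n → ℝ => Q G W y := by
  unfold Q; fun_prop

theorem measurable_rate (G : Fin r → Finset (Fin n)) (W : Finset (Fin n)) (i : Fin r) :
    Measurable fun y : Fin n → ℝ => rate G W y i :=
  measurable_const.min ((measurable_mass G W i).const_mul 2)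

theorem measurable_potential (G : Fin r → Finset (Fin n)) (W : Finset (Fin n)) (t : ℕ)
    (A B : ℝ) : Measurable (potential G W t A B) := by
  have h := (measurable_from_top (f := invT t)).comp (measurable_totalT G)
  exact ((measurable_Q G W).mul (h.const_mul (-A)).exp).sub (h.const_mul B)

theorem measurable_moveBound (G : Fin r → Finset (Fin n)) (W : Finset (Fin n)) (m t : ℕ)
    (A B : ℝ) (J : Finset (Fin r)) : Measurable fun y : Fin n → ℝ =>
      moveBound m t A B (Q G W y) (rate G W y) (blockT G y) J := by
  have h : Measurable fun y : Fin n → ℝ => invT t (totalT G y) :=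
    (measurable_from_top (f := invT t)).comp (measurable_totalT G)
  have h' : Measurable fun y : Fin n → ℝ => invT t (totalT G y - 1) :=
    (measurable_from_top (f := fun k => invT t (k - 1))).comp (measurable_totalT G)
  have hQ := measurable_Q G W
  have hr := measurable_rate G W
  have hm : Measurable fun y : Fin n → ℝ => ∏ i ∈ J, (1 - rate G W y i) :=
    Finset.measurable_prod _ fun i _ => (hr i).const_sub 1
  have hp : Measurable fun y : Fin n → ℝ => ∏ i ∈ J, (1 + rate G W y i) :=
    Finset.measurable_prod _ fun i _ => (hr i).const_add 1
  have hs : MeasurableSet {y : Fin n → ℝ | m + 1 ≤ ∑ i ∈ J, blockT G y i} :=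
    measurableSet_le measurable_const (Finset.measurable_sum _ fun i _ => measurable_blockT G i)
  unfold moveBound
  change Measurable fun y : Fin n → ℝ =>
    Q G W y * Real.exp (-A * invT t (totalT G y)) *
      ((∏ i ∈ J, (1 + rate G W y i) + ∏ i ∈ J, (1 - rate G W y i)) / 2) -
      B * invT t (totalT G y) - if m + 1 ≤ ∑ i ∈ J, blockT G y i then
      Q G W y * ((Real.exp (-A * invT t (totalT G y)) -
        Real.exp (-A * invT t (totalT G y - 1))) / 2) * ∏ i ∈ J, (1 - rate G W y i) +
        B * ((invT t (totalT G y - 1) - invT t (totalT G y)) / 2) else 0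
  refine Measurable.sub (by fun_prop) (Measurable.ite hs (by fun_prop) measurable_const)

end Combinatorics

/-! ### Conditioning: one iteration and one block reduction -/

section Probability

variable {Ω : Type*} {𝓖 𝓕 𝓗 : MeasurableSpace Ω} [mΩ : MeasurableSpace Ω] {P : Measure Ω}

theorem sum_setIntegral_fiber {ι : Type*} [Fintype ι] [DecidableEq ι] {E : Set Ω}
    (hE : MeasurableSet E) {J : Ω → ι} (hJ : ∀ S, MeasurableSet {ω | J ω = S}) {f : Ω → ℝ}
    (hf : IntegrableOn f E P) :
    ∫ ω in E, f ω ∂P = ∑ S, ∫ ω in E ∩ {ω | J ω = S}, f ω ∂P := by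
  have hU : E = ⋃ S, E ∩ {ω | J ω = S} := by
    ext ω; simp
  conv_lhs => rw [hU]
  refine integral_iUnion_fintype (fun S => hE.inter (hJ S)) ?_
    fun S => hf.mono_set Set.inter_subset_left
  intro S S' hne
  refine Set.disjoint_left.2 fun ω h1 h2 => hne ?_
  exact h1.2.symm.trans h2.2

variable [IsProbabilityMeasure P]

theorem integrableOn_of_ae_bound {A : Set Ω} (hA : MeasurableSet A) {f : Ω → ℝ} {K : ℝ}
    (hf : Measurable f) (hb : ∀ᵐ ω ∂P, ω ∈ A → |f ω| ≤ K) : IntegrableOn f A P :=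
  Measure.integrableOn_of_bounded (measure_ne_top P A) hf.aestronglyMeasurable
    ((ae_restrict_iff' hA).2 hb)

/-- Integrating over an event is integrating its conditional probability. -/
theorem setIntegral_inter_eq (hle : 𝓖 ≤ mΩ) {A H : Set Ω}
    (hA : MeasurableSet[𝓖] A) (hH : MeasurableSet H) {u : Ω → ℝ} (hu : Measurable[𝓖] u)
    (hint : IntegrableOn u A P) {c : Ω → ℝ}
    (hc : ∀ᵐ ω ∂P, ω ∈ A → (P⟦H | 𝓖⟧) ω = c ω) :
    IntegrableOn (fun ω => c ω * u ω) A P ∧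
      ∫ ω in A ∩ H, u ω ∂P = ∫ ω in A, c ω * u ω ∂P := by
  have hA' := hle _ hA
  have hiA : Integrable (A.indicator u) P := (integrable_indicator_iff hA').2 hint
  have hmul : A.indicator u * H.indicator (fun _ => (1 : ℝ)) = (A ∩ H).indicator u := by
    funext ω
    by_cases h1 : ω ∈ A <;> by_cases h2 : ω ∈ H <;> simp [h1, h2]
  have hiAH : Integrable ((A ∩ H).indicator u) P :=
    (integrable_indicator_iff (hA'.inter hH)).2 (hint.mono_set Set.inter_subset_left)
  have hpull := condExp_mul_of_stronglyMeasurable_left (μ := P) (m := 𝓖)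
    (f := A.indicator u) (g := H.indicator fun _ => (1 : ℝ))
    (hu.stronglyMeasurable.indicator hA) (by rwa [hmul])
    ((integrable_indicator_iff hH).2 (integrable_const _).integrableOn)
  have hae : P[A.indicator u * H.indicator (fun _ => (1 : ℝ)) | 𝓖] =ᵐ[P]
      A.indicator fun ω => c ω * u ω := by
    filter_upwards [hpull, hc] with ω h1 h2
    rw [h1]
    by_cases h3 : ω ∈ A
    · simp only [Pi.mul_apply, Set.indicator_of_mem h3]
      rw [h2 h3, mul_comm]
    · simp [h3]
  constructor
  · exact (integrable_indicator_iff hA').1 (integrable_condExp.congr hae)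
  · rw [← integral_indicator (hA'.inter hH), ← integral_indicator hA', ← integral_congr_ae hae,
      integral_condExp hle, hmul]

variable {n r m : ℕ} {G : Fin r → Finset (Fin n)} {M : Matrix (Fin m) (Fin n) ℝ}
  {E H : Set Ω} {J : Ω → Finset (Fin r)} {δ y y' : Ω → Fin n → ℝ}

/-- A function of the state whose mean over the coin is at most `ψ S` when `S` is the selected set
of blocks has conditional mean at most `∑ S, P(J = S) ψ S` after the iteration. -/
theorem IsIteration.setIntegral_le (h : IsIteration G M P 𝓕 𝓗 E J δ H y y')
    (hy : Measurable[𝓕] y) (hy' : Measurable y') (hE : MeasurableSet[𝓕] E)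
    {Φ θ : (Fin n → ℝ) → ℝ} {ψ : Finset (Fin r) → (Fin n → ℝ) → ℝ}
    (hΦ : Measurable Φ) (hθ : Measurable θ) (hψ : ∀ S, Measurable (ψ S))
    {good : Set (Fin n → ℝ)} (hgood : ∀ᵐ ω ∂P, ω ∈ E → y ω ∈ good) {K : ℝ}
    (hmove : ∀ z ∈ good, ∀ S d, IsDirection G M z S d → m + 1 ≤ ∑ i ∈ S, blockT G z i →
      (Φ (z + d) + Φ (z - d)) / 2 ≤ ψ S z ∧ |Φ (z + d)| ≤ K ∧ |Φ (z - d)| ≤ K)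
    (hstay : ∀ z ∈ good, ∀ S, ¬ m + 1 ≤ ∑ i ∈ S, blockT G z i → Φ z ≤ ψ S z)
    (hsum : ∀ z ∈ good, ∑ S : Finset (Fin r), (3 * (m : ℝ) / totalT G z) ^ S.card *
      (1 - 3 * (m : ℝ) / totalT G z) ^ (r - S.card) * ψ S z ≤ θ z)
    (hKΦ : ∀ z ∈ good, |Φ z| ≤ K) (hKθ : ∀ z ∈ good, |θ z| ≤ K)
    (hKψ : ∀ z ∈ good, ∀ S, |ψ S z| ≤ K) :
    ∫ ω in E, Φ (y' ω) ∂P ≤ ∫ ω in E, θ (y ω) ∂P := by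
  classical
  have hyH : Measurable[𝓗] y := hy.mono h.past_le le_rfl
  have hyΩ : Measurable y := hyH.mono h.le_ambient le_rfl
  have hδΩ : Measurable δ := h.measurable_δ.mono h.le_ambient le_rfl
  have hEH : MeasurableSet[𝓗] E := h.past_le _ hE
  have hEΩ : MeasurableSet E := h.le_ambient _ hEH
  have hJΩ : ∀ S, MeasurableSet {ω | J ω = S} := fun S => h.le_ambient _ (h.measurable_J S)
  have hiΦ : IntegrableOn (fun ω => Φ (y' ω)) E P := by
    refine integrableOn_of_ae_bound (K := K) hEΩ (hΦ.comp hy') ?_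
    filter_upwards [hgood, h.move, h.stay] with ω h1 h2 h3 hω
    by_cases hl : m + 1 ≤ ∑ i ∈ J ω, blockT G (y ω) i
    · obtain ⟨hd, hin, hout⟩ := h2 hω hl
      obtain ⟨-, ha, hb⟩ := hmove _ (h1 hω) _ _ hd hl
      by_cases hH : ω ∈ H
      · rwa [hin hH]
      · rwa [hout hH]
    · rw [h3 hω hl]; exact hKΦ _ (h1 hω)
  have hiψ : ∀ S, IntegrableOn (fun ω => ψ S (y ω)) E P := fun S => by
    refine integrableOn_of_ae_bound (K := K) hEΩ ((hψ S).comp hyΩ) ?_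
    filter_upwards [hgood] with ω h1 hω using hKψ _ (h1 hω) S
  have hiθ : IntegrableOn (fun ω => θ (y ω)) E P := by
    refine integrableOn_of_ae_bound (K := K) hEΩ (hθ.comp hyΩ) ?_
    filter_upwards [hgood] with ω h1 hω using hKθ _ (h1 hω)
  -- On a fibre of `J` the conditioning is on `𝓗`, which knows `δ`, so only the coin is averaged.
  -- The law of `J` given the smaller `𝓕` enters afterwards, because `ψ S (y ω)` depends on the past
  -- alone.
  have hstep : ∀ S, ∫ ω in E ∩ {ω | J ω = S}, Φ (y' ω) ∂P ≤
      ∫ ω in E ∩ {ω | J ω = S}, ψ S (y ω) ∂P := by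
    intro S
    set A := E ∩ {ω | J ω = S} with hAdef
    have hA : MeasurableSet[𝓗] A := hEH.inter (h.measurable_J S)
    set L : Set Ω := {ω | m + 1 ≤ ∑ i ∈ S, blockT G (y ω) i} with hLdef
    have hL : MeasurableSet[𝓗] L := by
      have : MeasurableSet {z : Fin n → ℝ | m + 1 ≤ ∑ i ∈ S, blockT G z i} :=
        measurableSet_le measurable_const
          (Finset.measurable_sum _ fun i _ => measurable_blockT G i)
      exact hyH this
    have hAE : A ⊆ E := Set.inter_subset_left
    have hLΩ := h.le_ambient _ hL
    have hAΩ := h.le_ambient _ hA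
    have hALΩ := hAΩ.inter hLΩ
    rw [← integral_inter_add_sdiff hLΩ (hiΦ.mono_set hAE),
      ← integral_inter_add_sdiff hLΩ ((hiψ S).mono_set hAE)]
    refine add_le_add ?_ ?_
    · have hdir : ∀ᵐ ω ∂P, ω ∈ A ∩ L → y ω ∈ good ∧ IsDirection G M (y ω) S (δ ω) ∧
          m + 1 ≤ ∑ i ∈ S, blockT G (y ω) i ∧
          (ω ∈ H → y' ω = y ω + δ ω) ∧ (ω ∉ H → y' ω = y ω - δ ω) := by
        filter_upwards [hgood, h.move] with ω h1 h2 hω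
        have hJω : J ω = S := hω.1.2
        have hl : m + 1 ≤ ∑ i ∈ S, blockT G (y ω) i := hω.2
        have h3 := h2 hω.1.1 (by rwa [hJω])
        rw [hJω] at h3
        exact ⟨h1 hω.1.1, h3.1, hl, h3.2⟩
      have hmp : Measurable[𝓗] fun ω => Φ (y ω + δ ω) := hΦ.comp (hyH.add h.measurable_δ)
      have hmm : Measurable[𝓗] fun ω => Φ (y ω - δ ω) := hΦ.comp (hyH.sub h.measurable_δ)
      have hip : IntegrableOn (fun ω => Φ (y ω + δ ω)) (A ∩ L) P := by
        refine integrableOn_of_ae_bound (K := K) hALΩ (hmp.mono h.le_ambient le_rfl) ?_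
        filter_upwards [hdir] with ω h1 hω
        obtain ⟨g1, g2, g3, -⟩ := h1 hω
        exact (hmove _ g1 _ _ g2 g3).2.1
      have him : IntegrableOn (fun ω => Φ (y ω - δ ω)) (A ∩ L) P := by
        refine integrableOn_of_ae_bound (K := K) hALΩ (hmm.mono h.le_ambient le_rfl) ?_
        filter_upwards [hdir] with ω h1 hω
        obtain ⟨g1, g2, g3, -⟩ := h1 hω
        exact (hmove _ g1 _ _ g2 g3).2.2
      have hcoin : ∀ᵐ ω ∂P, ω ∈ A ∩ L → (P⟦H | 𝓗⟧) ω = 1 / 2 := by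
        filter_upwards [h.law_H] with ω h1 hω using h1 hω.1.1
      have hHp := setIntegral_inter_eq h.le_ambient (hA.inter hL) h.measurable_H hmp hip hcoin
      have hHm := setIntegral_inter_eq h.le_ambient (hA.inter hL) h.measurable_H hmm him hcoin
      rw [← integral_inter_add_sdiff h.measurable_H
        (hiΦ.mono_set (Set.inter_subset_left.trans hAE))]
      have e1 : ∫ ω in (A ∩ L) ∩ H, Φ (y' ω) ∂P = ∫ ω in (A ∩ L) ∩ H, Φ (y ω + δ ω) ∂P := by
        refine setIntegral_congr_ae (hALΩ.inter h.measurable_H) ?_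
        filter_upwards [hdir] with ω h1 hω
        rw [(h1 hω.1).2.2.2.1 hω.2]
      have e2 : ∫ ω in (A ∩ L) \ H, Φ (y' ω) ∂P = ∫ ω in (A ∩ L) \ H, Φ (y ω - δ ω) ∂P := by
        refine setIntegral_congr_ae (hALΩ.diff h.measurable_H) ?_
        filter_upwards [hdir] with ω h1 hω
        rw [(h1 hω.1).2.2.2.2 hω.2]
      have e3 := integral_inter_add_sdiff h.measurable_H him
      have e4 : ∫ ω in A ∩ L, (Φ (y ω + δ ω) + Φ (y ω - δ ω)) / 2 ∂P ≤
          ∫ ω in A ∩ L, ψ S (y ω) ∂P := by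
        refine setIntegral_mono_on_ae ((hip.add him).div_const 2)
          ((hiψ S).mono_set (Set.inter_subset_left.trans hAE)) hALΩ ?_
        filter_upwards [hdir] with ω h1 hω
        obtain ⟨g1, g2, g3, -⟩ := h1 hω
        exact (hmove _ g1 _ _ g2 g3).1
      rw [integral_div, integral_add hip him] at e4
      have e5 := hHp.2
      have e6 := hHm.2
      rw [integral_const_mul] at e5 e6
      rw [e1, e2]
      linarith
    · refine setIntegral_mono_on_ae (hiΦ.mono_set (Set.sdiff_subset.trans hAE))
        ((hiψ S).mono_set (Set.sdiff_subset.trans hAE)) (hAΩ.diff hLΩ) ?_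
      filter_upwards [hgood, h.stay] with ω h1 h2 hω
      have hJω : J ω = S := hω.1.2
      have hl : ¬ m + 1 ≤ ∑ i ∈ S, blockT G (y ω) i := hω.2
      rw [h2 hω.1.1 (by rwa [hJω])]
      exact hstay _ (h1 hω.1.1) S hl
  have hlaw : ∀ S, _ := fun S => setIntegral_inter_eq (h.past_le.trans h.le_ambient) hE (hJΩ S)
    ((hψ S).comp hy) (hiψ S) (h.law_J S)
  calc ∫ ω in E, Φ (y' ω) ∂P = ∑ S, ∫ ω in E ∩ {ω | J ω = S}, Φ (y' ω) ∂P :=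
        sum_setIntegral_fiber hEΩ hJΩ hiΦ
    _ ≤ ∑ S, ∫ ω in E ∩ {ω | J ω = S}, ψ S (y ω) ∂P := Finset.sum_le_sum fun S _ => hstep S
    _ = ∑ S, ∫ ω in E, _ ∂P := Finset.sum_congr rfl fun S _ => (hlaw S).2
    _ = ∫ ω in E, ∑ S, _ ∂P := (integral_finsetSum _ fun S _ => (hlaw S).1).symm
    _ ≤ ∫ ω in E, θ (y ω) ∂P := by
        refine setIntegral_mono_on_ae (integrable_finsetSum _ fun S _ => (hlaw S).1) hiθ hEΩ ?_
        filter_upwards [hgood] with ω h1 hω using hsum _ (h1 hω)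

/-- The first loop does not change the expectation of `Q`. -/
theorem IsBlockReduction.integral_Q_eq (hG : IsPartition G) (W : Finset (Fin n)) {i : Fin r}
    (hle : 𝓕 ≤ mΩ) (h : IsBlockReduction G M P 𝓕 i y y') (hy : Measurable[𝓕] y)
    (hy' : Measurable y') (hf : ∀ᵐ ω ∂P, Feasible G (y ω)) :
    ∫ ω, Q G W (y' ω) ∂P = ∫ ω, Q G W (y ω) ∂P := by
  -- The factors of the other blocks are unchanged by the pass and known from the past, so they pull
  -- out of the conditional expectation; the remaining factor is affine in `y'`.
  set ρ : (Fin n → ℝ) → ℝ := fun z => ∏ i' ∈ Finset.univ.erase i, (1 - mass G W z i') with hρ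
  have hρm : Measurable ρ :=
    Finset.measurable_prod _ fun i' _ => (measurable_mass G W i').const_sub 1
  have hρ01 : ∀ z, Feasible G z → |ρ z| ≤ 1 := fun z hz => by
    rw [abs_of_nonneg (Finset.prod_nonneg fun i' _ => sub_nonneg.2 (hz.mass_mem i').2)]
    exact Finset.prod_le_one (fun i' _ => sub_nonneg.2 (hz.mass_mem i').2) fun i' _ =>
      sub_le_self _ (hz.mass_mem i').1
  have hyΩ : Measurable y := hy.mono hle le_rfl
  have hQ : ∀ z, Q G W z = ρ z * (1 - mass G W z i) := fun z => by
    rw [Q_eq, mul_comm]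
    exact (Finset.mul_prod_erase _ _ (Finset.mem_univ i)).symm
  have hf' : ∀ᵐ ω ∂P, Feasible G (y' ω) ∧ ρ (y' ω) = ρ (y ω) := by
    filter_upwards [hf, h.extreme] with ω h1 h2
    have h3 := extremePoints_subset h2
    refine ⟨h1.of_mem_blockPolytope hG h3, Finset.prod_congr rfl fun i' hi' => ?_⟩
    have : mass G W (y' ω) i' = mass G W (y ω) i' :=
      Finset.sum_congr rfl fun j hj =>
        h3.2.2.2 j (hG.not_mem (Finset.ne_of_mem_erase hi') (Finset.mem_inter.1 hj).2)
    rw [this]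
  have hiρ : Integrable (fun ω => ρ (y ω)) P :=
    Integrable.of_bound (hρm.comp hyΩ).aestronglyMeasurable 1
      (by filter_upwards [hf] with ω h1 using hρ01 _ h1)
  have hint : ∀ x : Ω → Fin n → ℝ, Measurable x → (∀ᵐ ω ∂P, Feasible G (x ω)) → ∀ j,
      Integrable (fun ω => ρ (y ω) * x ω j) P := fun x hx hxf j => by
    refine Integrable.of_bound ((hρm.comp hyΩ).mul
      ((measurable_pi_apply j).comp hx)).aestronglyMeasurable 1 ?_
    filter_upwards [hf, hxf] with ω h1 h2
    rw [norm_mul]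
    exact mul_le_one₀ (hρ01 _ h1) (norm_nonneg _)
      (by rw [Real.norm_eq_abs, abs_of_nonneg (h2.mem j).1]; exact (h2.mem j).2)
  have hcoord : ∀ j, ∫ ω, ρ (y ω) * y' ω j ∂P = ∫ ω, ρ (y ω) * y ω j ∂P := fun j => by
    have hij : Integrable (fun ω => y' ω j) P := by
      refine Integrable.of_bound ((measurable_pi_apply j).comp hy').aestronglyMeasurable 1 ?_
      filter_upwards [hf'] with ω h1
      rw [Real.norm_eq_abs, abs_of_nonneg (h1.1.mem j).1]; exact (h1.1.mem j).2
    have hpull := condExp_mul_of_stronglyMeasurable_left (μ := P) (m := 𝓕)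
      (f := fun ω => ρ (y ω)) (g := fun ω => y' ω j) (hρm.comp hy).stronglyMeasurable
      (hint y' hy' (hf'.mono fun ω h1 => h1.1) j) hij
    have e := integral_condExp hle (μ := P) (f := (fun ω => ρ (y ω)) * fun ω => y' ω j)
    refine e.symm.trans (integral_congr_ae ?_)
    filter_upwards [hpull, h.unbiased j] with ω h1 h2
    rw [h1, Pi.mul_apply, h2]
  have hexpand : ∀ x : Ω → Fin n → ℝ, Measurable x → (∀ᵐ ω ∂P, Feasible G (x ω)) →
      ∫ ω, ρ (y ω) * (1 - mass G W (x ω) i) ∂P =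
        ∫ ω, ρ (y ω) ∂P - ∑ j ∈ W ∩ G i, ∫ ω, ρ (y ω) * x ω j ∂P := fun x hx hxf => by
    rw [← integral_finsetSum _ fun j _ => hint x hx hxf j,
      ← integral_sub hiρ (integrable_finsetSum _ fun j _ => hint x hx hxf j)]
    refine integral_congr_ae (Filter.Eventually.of_forall fun ω => ?_)
    simp only [mass]
    rw [mul_sub, mul_one, Finset.mul_sum]
  calc ∫ ω, Q G W (y' ω) ∂P = ∫ ω, ρ (y ω) * (1 - mass G W (y' ω) i) ∂P :=
        integral_congr_ae (by filter_upwards [hf'] with ω h1; rw [hQ, h1.2])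
    _ = ∫ ω, ρ (y ω) * (1 - mass G W (y ω) i) ∂P := by
        rw [hexpand y' hy' (hf'.mono fun ω h1 => h1.1), hexpand y hyΩ hf]
        simp only [hcoord]
    _ = ∫ ω, Q G W (y ω) ∂P := by simp only [hQ]

end Probability

/-! ### Steady states, uniform bounds and drift of one iteration -/

/-- The invariant of the second loop. -/
structure Steady {n r : ℕ} (m : ℕ) (G : Fin r → Finset (Fin n)) (y : Fin n → ℝ) : Prop
    extends Feasible G y where
  small : ∀ i, blockT G y i ≤ m

section Bounds

variable {n r m t : ℕ} {G : Fin r → Finset (Fin n)} {M : Matrix (Fin m) (Fin n) ℝ}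
  {W : Finset (Fin n)} {y δ : Fin n → ℝ} {J : Finset (Fin r)} {A B : ℝ}

theorem IsDirection.steady_add (h : IsDirection G M y J δ) (hy : Steady m G y) :
    Steady m G (y + δ) :=
  ⟨h.feasible_add hy.toFeasible, fun i => (h.blockT_add_le i).trans (hy.small i)⟩

theorem IsDirection.steady_sub (h : IsDirection G M y J δ) (hy : Steady m G y) :
    Steady m G (y - δ) :=
  ⟨h.feasible_sub hy.toFeasible, fun i => (h.blockT_sub_le i).trans (hy.small i)⟩

theorem exp_neg_mul_invT_mem (hA : 0 ≤ A) (T : ℕ) :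
    Real.exp (-A * invT t T) ∈ Set.Icc (0 : ℝ) 1 :=
  ⟨(Real.exp_pos _).le, Real.exp_le_one_iff.2 (by nlinarith [invT_nonneg t T])⟩

theorem mul_invT_mem (ht : 0 < t) (hB : 0 ≤ B) (T : ℕ) : B * invT t T ∈ Set.Icc (0 : ℝ) B := by
  refine ⟨mul_nonneg hB (invT_nonneg t T), mul_le_of_le_one_right hB ?_⟩
  refine (invT_le ht T).trans ?_
  rw [div_le_one (by exact_mod_cast ht)]
  exact_mod_cast ht

theorem Feasible.abs_potential_le (hy : Feasible G y) (ht : 0 < t) (hA : 0 ≤ A) (hB : 0 ≤ B) :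
    |potential G W t A B y| ≤ 1 + B := by
  have h1 := exp_neg_mul_invT_mem (t := t) hA (totalT G y)
  have h2 := mul_invT_mem ht hB (totalT G y)
  have h3 := mul_le_one₀ (hy.Q_le_one (W := W)) h1.1 h1.2
  have h4 := mul_nonneg (hy.Q_nonneg (W := W)) h1.1
  rw [potential, abs_le]
  constructor <;> linarith [h2.1, h2.2]

theorem Feasible.abs_moveBound_le (hy : Feasible G y) (ht : 0 < t) (hA : 0 ≤ A) (hB : 0 ≤ B) :
    |moveBound m t A B (Q G W y) (rate G W y) (blockT G y) J| ≤ 2 ^ r + 2 + 2 * B := by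
  have f1 := exp_neg_mul_invT_mem (t := t) hA (∑ i, blockT G y i)
  have f2 := exp_neg_mul_invT_mem (t := t) hA (∑ i, blockT G y i - 1)
  have g1 := mul_invT_mem ht hB (∑ i, blockT G y i)
  have g2 := mul_invT_mem ht hB (∑ i, blockT G y i - 1)
  have q0 := hy.Q_nonneg (W := W)
  have q1 := hy.Q_le_one (W := W)
  have p0 : 0 ≤ ∏ i ∈ J, (1 + rate G W y i) :=
    Finset.prod_nonneg fun i _ => by linarith [(hy.rate_mem (W := W) i).1]
  have p1 : ∏ i ∈ J, (1 + rate G W y i) ≤ 2 ^ r := by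
    calc ∏ i ∈ J, (1 + rate G W y i) ≤ ∏ _i ∈ J, (2 : ℝ) :=
          Finset.prod_le_prod (fun i _ => by linarith [(hy.rate_mem (W := W) i).1])
            fun i _ => by linarith [(hy.rate_mem (W := W) i).2]
      _ ≤ 2 ^ r := by
          rw [Finset.prod_const]
          exact pow_le_pow_right₀ one_le_two (by simpa using J.card_le_univ)
  have n0 : 0 ≤ ∏ i ∈ J, (1 - rate G W y i) :=
    Finset.prod_nonneg fun i _ => sub_nonneg.2 (hy.rate_mem (W := W) i).2
  have n1 : ∏ i ∈ J, (1 - rate G W y i) ≤ 1 :=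
    Finset.prod_le_one (fun i _ => sub_nonneg.2 (hy.rate_mem (W := W) i).2) fun i _ =>
      sub_le_self _ (hy.rate_mem (W := W) i).1
  unfold moveBound
  revert f1 f2 g1 g2 q0 q1 p0 p1 n0 n1
  generalize Real.exp (-A * invT t (∑ i, blockT G y i)) = f
  generalize Real.exp (-A * invT t (∑ i, blockT G y i - 1)) = f'
  generalize invT t (∑ i, blockT G y i) = h
  generalize invT t (∑ i, blockT G y i - 1) = h'
  generalize ∏ i ∈ J, (1 + rate G W y i) = U
  generalize ∏ i ∈ J, (1 - rate G W y i) = V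
  generalize Q G W y = q
  intro f1 f2 g1 g2 q0 q1 p0 p1 n0 n1
  have h2r : (1 : ℝ) ≤ 2 ^ r := one_le_pow₀ one_le_two
  have a1 : |q * f * ((U + V) / 2)| ≤ 2 ^ r := by
    rw [abs_of_nonneg (mul_nonneg (mul_nonneg q0 f1.1) (by linarith))]
    have := mul_le_mul (mul_le_one₀ q1 f1.1 f1.2) (show (U + V) / 2 ≤ 2 ^ r by linarith)
      (by linarith) zero_le_one
    rwa [one_mul] at this
  have a2 : |q * ((f - f') / 2) * V| ≤ 1 := by
    rw [abs_mul, abs_mul, abs_of_nonneg q0, abs_of_nonneg n0]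
    refine mul_le_one₀ (mul_le_one₀ q1 (abs_nonneg _) ?_) n0 n1
    rw [abs_le]; constructor <;> linarith [f1.1, f1.2, f2.1, f2.2]
  rw [abs_le] at a1 a2
  have := g1.1
  have := g1.2
  have := g2.1
  have := g2.2
  split_ifs <;> rw [abs_le] <;> constructor <;> linarith [a1.1, a1.2, a2.1, a2.2]

end Bounds

/-- A heavy set occurs with probability at least `1/4` and then costs `T` at least `1/2` in mean
over the coin, hence the `1/8`. -/
theorem sum_totalT_move_le {r m t : ℕ} (τ : Fin r → ℕ) (hmt : 12 * m ≤ t)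
    (hτ : ∀ i, τ i ≤ m) (hT : t < ∑ i, τ i) {p : ℝ} (hp : p = 3 * (m : ℝ) / (∑ i, τ i : ℕ)) :
    ∑ S : Finset (Fin r), p ^ S.card * (1 - p) ^ (r - S.card) *
      (((∑ i, τ i : ℕ) : ℝ) - if m + 1 ≤ ∑ i ∈ S, τ i then 1 / 2 else 0) ≤
        ((∑ i, τ i : ℕ) : ℝ) - 1 / 8 := by
  have hm : 0 < m := by
    rcases Nat.eq_zero_or_pos m with rfl | h
    · have : ∑ i, τ i = 0 := Finset.sum_eq_zero fun i _ => Nat.le_zero.1 (hτ i)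
      omega
    · exact h
  have hsumT : ∑ i, (τ i : ℝ) = ((∑ i, τ i : ℕ) : ℝ) := by push_cast; rfl
  have hT0 : (0 : ℝ) < (∑ i, τ i : ℕ) := by exact_mod_cast (by omega : 0 < ∑ i, τ i)
  have hmT : 12 * (m : ℝ) ≤ (∑ i, τ i : ℕ) := by exact_mod_cast (by omega : 12 * m ≤ ∑ i, τ i)
  have hlight := sum_light_le hm τ hτ p
    ⟨by rw [hp]; positivity, by rw [hp, div_le_one hT0]; linarith [(m.cast_nonneg : (0 : ℝ) ≤ m)]⟩
    (by rw [hsumT, hp]; field_simp)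
  have e : ∀ S : Finset (Fin r), p ^ S.card * (1 - p) ^ (r - S.card) *
      (((∑ i, τ i : ℕ) : ℝ) - if m + 1 ≤ ∑ i ∈ S, τ i then 1 / 2 else 0) =
      p ^ S.card * (1 - p) ^ (r - S.card) * (((∑ i, τ i : ℕ) : ℝ) - 1 / 2) +
        1 / 2 * (if m + 1 ≤ ∑ i ∈ S, τ i then 0 else p ^ S.card * (1 - p) ^ (r - S.card)) :=
    fun S => by split_ifs <;> ring
  rw [Finset.sum_congr rfl fun S _ => e S, Finset.sum_add_distrib, ← Finset.sum_mul,
    ← Finset.mul_sum, sum_pow_eq_one]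
  linarith

section Iteration

variable {Ω : Type*} {𝓕 𝓗 : MeasurableSpace Ω} [mΩ : MeasurableSpace Ω] {P : Measure Ω}
  {n r m t : ℕ} {G : Fin r → Finset (Fin n)} {M : Matrix (Fin m) (Fin n) ℝ}
  {E H : Set Ω} {J : Ω → Finset (Fin r)} {δ y y' : Ω → Fin n → ℝ}

theorem IsIteration.ae_steady (h : IsIteration G M P 𝓕 𝓗 E J δ H y y')
    (hst : ∀ᵐ ω ∂P, Steady m G (y ω)) : ∀ᵐ ω ∂P, ω ∈ E → Steady m G (y' ω) := by
  filter_upwards [hst, h.move, h.stay] with ω h1 h2 h3 hω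
  by_cases hl : m + 1 ≤ ∑ i ∈ J ω, blockT G (y ω) i
  · obtain ⟨hd, hin, hout⟩ := h2 hω hl
    by_cases hH : ω ∈ H
    · rw [hin hH]; exact hd.steady_add h1
    · rw [hout hH]; exact hd.steady_sub h1
  · rwa [h3 hω hl]

variable [IsProbabilityMeasure P]

theorem IsIteration.setIntegral_potential_le (hG : IsPartition G) (W : Finset (Fin n))
    (ht : 0 < t) (hmt : 12 * m ≤ t) {b : ℝ} (hb : 2 < b) (htb : 3072 * m * Real.log b ≤ t)
    {A B : ℝ} (hA : A = 4718592 * (m : ℝ) ^ 2 * Real.log b ^ 2)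
    (hB : B = 4608 * (m : ℝ) ^ 2 / b ^ 16)
    (h : IsIteration G M P 𝓕 𝓗 {ω | t < totalT G (y ω)} J δ H y y')
    (hy : Measurable[𝓕] y) (hy' : Measurable y') (hst : ∀ᵐ ω ∂P, Steady m G (y ω)) :
    ∫ ω in {ω | t < totalT G (y ω)}, potential G W t A B (y' ω) ∂P ≤
      ∫ ω in {ω | t < totalT G (y ω)}, potential G W t A B (y ω) ∂P := by
  have hA0 : 0 ≤ A := by rw [hA]; positivity
  have hB0 : 0 ≤ B := by rw [hB]; positivity
  have hE : MeasurableSet[𝓕] {ω | t < totalT G (y ω)} :=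
    hy (measurableSet_lt measurable_const (measurable_totalT G))
  have hK : ∀ z, Feasible G z → |potential G W t A B z| ≤ 2 ^ r + 2 + 2 * B := fun z hz => by
    refine (hz.abs_potential_le ht hA0 hB0).trans ?_
    have : (0 : ℝ) ≤ 2 ^ r := by positivity
    linarith
  refine h.setIntegral_le hy hy' hE (measurable_potential G W t A B)
    (measurable_potential G W t A B) (fun S => measurable_moveBound G W m t A B S)
    (good := {z | Steady m G z ∧ t < totalT G z}) (K := 2 ^ r + 2 + 2 * B)
    ?_ ?_ ?_ ?_ ?_ ?_ ?_
  · filter_upwards [hst] with ω h1 hω using ⟨h1, hω⟩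
  · intro z hz S d hd hS
    have hf := hz.1.toFeasible
    exact ⟨hd.potential_mean_le hG ht hA0 hB0 hf hS, hK _ (hd.feasible_add hf),
      hK _ (hd.feasible_sub hf)⟩
  · intro z hz S hS
    exact potential_le_moveBound hz.1.toFeasible hS
  · intro z hz
    have hf := hz.1.toFeasible
    exact sum_moveBound_le ht hmt hb htb (rate G W z) (blockT G z) (fun i => hf.rate_mem i)
      hz.1.small hz.2 hf.Q_nonneg hf.Q_le_exp rfl hA hB
  · exact fun z hz => hK z hz.1.toFeasible
  · exact fun z hz => hK z hz.1.toFeasible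
  · exact fun z hz S => hz.1.toFeasible.abs_moveBound_le ht hA0 hB0

theorem abs_totalT_sub_le (z : Fin n → ℝ) {c : ℝ} (hc : c ∈ Set.Icc (0 : ℝ) 1) :
    |(totalT G z : ℝ) - c| ≤ r * n + 1 := by
  have h1 : (totalT G z : ℝ) ≤ r * n := by exact_mod_cast totalT_le G z
  have h2 : (0 : ℝ) ≤ totalT G z := Nat.cast_nonneg _
  rw [abs_le]
  constructor <;> linarith [hc.1, hc.2]

theorem IsIteration.setIntegral_totalT_le (hG : IsPartition G) (hmt : 12 * m ≤ t)
    (h : IsIteration G M P 𝓕 𝓗 {ω | t < totalT G (y ω)} J δ H y y')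
    (hy : Measurable[𝓕] y) (hy' : Measurable y') (hst : ∀ᵐ ω ∂P, Steady m G (y ω)) :
    ∫ ω in {ω | t < totalT G (y ω)}, (totalT G (y' ω) : ℝ) ∂P ≤
      ∫ ω in {ω | t < totalT G (y ω)}, ((totalT G (y ω) : ℝ) - 1 / 8) ∂P := by
  have hE : MeasurableSet[𝓕] {ω | t < totalT G (y ω)} :=
    hy (measurableSet_lt measurable_const (measurable_totalT G))
  have hm : Measurable fun z : Fin n → ℝ => (totalT G z : ℝ) :=
    (measurable_from_top (f := fun k : ℕ => (k : ℝ))).comp (measurable_totalT G)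
  have hK : ∀ z, |(totalT G z : ℝ)| ≤ r * n + 1 := fun z => by
    simpa using abs_totalT_sub_le (G := G) z (c := 0) ⟨le_rfl, zero_le_one⟩
  refine h.setIntegral_le hy hy' hE hm (θ := fun z => (totalT G z : ℝ) - 1 / 8)
    (hm.sub_const _)
    (ψ := fun S z => (totalT G z : ℝ) - if m + 1 ≤ ∑ i ∈ S, blockT G z i then 1 / 2 else 0)
    (fun S => hm.sub (Measurable.ite (measurableSet_le measurable_const
      (Finset.measurable_sum _ fun i _ => measurable_blockT G i)) measurable_const
      measurable_const))
    (good := {z | Steady m G z ∧ t < totalT G z}) (K := r * n + 1) ?_ ?_ ?_ ?_ ?_ ?_ ?_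
  · filter_upwards [hst] with ω h1 hω using ⟨h1, hω⟩
  · intro z hz S d hd hS
    refine ⟨?_, hK _, hK _⟩
    rw [if_pos hS]
    have hle₁ : (totalT G (z + d) : ℝ) ≤ totalT G z := by exact_mod_cast hd.totalT_add_le
    have hle₂ : (totalT G (z - d) : ℝ) ≤ totalT G z := by exact_mod_cast hd.totalT_sub_le
    rcases hd.totalT_lt hG hz.1.toFeasible with hlt | hlt
    · have : (totalT G (z + d) : ℝ) + 1 ≤ totalT G z := by exact_mod_cast hlt
      linarith
    · have : (totalT G (z - d) : ℝ) + 1 ≤ totalT G z := by exact_mod_cast hlt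
      linarith
  · intro z hz S hS
    rw [if_neg hS, sub_zero]
  · intro z hz
    exact sum_totalT_move_le (blockT G z) hmt hz.1.small hz.2 rfl
  · exact fun z _ => hK z
  · exact fun z _ => abs_totalT_sub_le z ⟨by norm_num, by norm_num⟩
  · intro z _ S
    exact abs_totalT_sub_le z (by split_ifs <;> constructor <;> norm_num)

end Iteration

/-! ### Whole executions: termination and the limiting bound -/

section Run

variable {Ω : Type*} [mΩ : MeasurableSpace Ω] {P : Measure Ω}
  {n r m t : ℕ} {G : Fin r → Finset (Fin n)} {M : Matrix (Fin m) (Fin n) ℝ} {y : Fin n → ℝ}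

theorem Run.measurable (R : Run G M y t P) (k : ℕ) : Measurable (R.x k) :=
  (R.adapted k).mono (R.𝓕.le k) le_rfl

theorem Run.ae_reduced (R : Run G M y t P) (hG : IsPartition G) (hy : Feasible G y) {k : ℕ}
    (hk : k ≤ r) : ∀ᵐ ω ∂P, Feasible G (R.x k ω) ∧
      ∀ i : Fin r, (i : ℕ) < k → blockT G (R.x k ω) i ≤ m := by
  induction k with
  | zero =>
    refine Filter.Eventually.of_forall fun ω => ⟨by rwa [R.start ω], fun i hi => ?_⟩
    exact absurd hi (Nat.not_lt_zero _)
  | succ k ih =>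
    filter_upwards [ih (by omega), (R.reduce ⟨k, hk⟩).extreme] with ω h1 h2
    have h3 := extremePoints_subset h2
    refine ⟨h1.1.of_mem_blockPolytope hG h3, fun i hi => ?_⟩
    by_cases hik : i = ⟨k, hk⟩
    · rw [hik]; exact blockT_le_of_extreme h2
    · rw [blockT_congr_of_mem_blockPolytope hG h3 hik]
      refine h1.2 i ?_
      have : (i : ℕ) ≠ k := fun h => hik (Fin.ext h)
      omega

theorem Run.ae_steady (R : Run G M y t P) (hG : IsPartition G) (hy : Feasible G y) {k : ℕ}
    (hk : r ≤ k) : ∀ᵐ ω ∂P, Steady m G (R.x k ω) := by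
  induction k, hk using Nat.le_induction with
  | base =>
    filter_upwards [R.ae_reduced hG hy le_rfl] with ω h using ⟨h.1, fun i => h.2 i i.2⟩
  | succ k hk ih =>
    filter_upwards [ih, (R.iterate k hk).ae_steady ih, R.halt k hk] with ω h1 h2 h3
    rcases lt_or_ge t (totalT G (R.x k ω)) with h4 | h4
    · exact h2 h4
    · rwa [h3 h4]

theorem Run.integral_step_le (R : Run G M y t P) {k : ℕ} (hk : r ≤ k) {f : (Fin n → ℝ) → ℝ}
    (hf : ∀ l, r ≤ l → Integrable (fun ω => f (R.x l ω)) P) {c : ℝ}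
    (hc : ∫ ω in {ω | t < totalT G (R.x k ω)}, f (R.x (k + 1) ω) ∂P ≤
      ∫ ω in {ω | t < totalT G (R.x k ω)}, f (R.x k ω) ∂P - c) :
    ∫ ω, f (R.x (k + 1) ω) ∂P ≤ ∫ ω, f (R.x k ω) ∂P - c := by
  have hE : MeasurableSet {ω | t < totalT G (R.x k ω)} :=
    R.measurable k (measurableSet_lt measurable_const (measurable_totalT G))
  rw [← integral_add_compl hE (hf (k + 1) (by omega)), ← integral_add_compl hE (hf k hk)]
  have : ∫ ω in {ω | t < totalT G (R.x k ω)}ᶜ, f (R.x (k + 1) ω) ∂P =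
      ∫ ω in {ω | t < totalT G (R.x k ω)}ᶜ, f (R.x k ω) ∂P := by
    refine setIntegral_congr_ae hE.compl ?_
    filter_upwards [R.halt k hk] with ω h hω
    rw [h (not_lt.1 hω)]
  linarith

/-- Once halted, the vector is frozen. The output is thus an almost sure limit of the states, which
yields both its measurability and the passage of bounds to it. -/
theorem Run.ae_eventually_eq_output (R : Run G M y t P) (hterm : ∀ᵐ ω ∂P, R.Terminates ω) :
    ∀ᵐ ω ∂P, ∀ᶠ k in Filter.atTop, R.x k ω = R.output ω := by
  classical
  have hhalt : ∀ᵐ ω ∂P, ∀ k, r ≤ k → totalT G (R.x k ω) ≤ t → R.x (k + 1) ω = R.x k ω := by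
    rw [ae_all_iff]
    intro k
    by_cases hk : r ≤ k
    · filter_upwards [R.halt k hk] with ω h _ using h
    · exact Filter.Eventually.of_forall fun ω h => absurd h hk
  filter_upwards [hterm, hhalt] with ω h1 h2
  have hspec := Nat.find_spec h1
  have hout : R.output ω = R.x (Nat.find h1) ω := by
    unfold Run.output
    rw [dif_pos h1]
  filter_upwards [Filter.eventually_ge_atTop (Nat.find h1)] with k hk
  rw [hout]
  induction k, hk using Nat.le_induction with
  | base => rfl
  | succ k hk ih => rw [h2 k (hspec.1.trans hk) (by rw [ih]; exact hspec.2), ih]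

variable [IsProbabilityMeasure P]

theorem Run.integral_Q_reduced (R : Run G M y t P) (hG : IsPartition G) (hy : Feasible G y)
    (W : Finset (Fin n)) {k : ℕ} (hk : k ≤ r) : ∫ ω, Q G W (R.x k ω) ∂P = Q G W y := by
  induction k with
  | zero => simp [R.start]
  | succ k ih =>
    rw [← ih (by omega)]
    exact (R.reduce ⟨k, hk⟩).integral_Q_eq hG W (R.𝓕.le k) (R.adapted k) (R.measurable _)
      ((R.ae_reduced hG hy (by omega)).mono fun ω h => h.1)

theorem Run.integral_potential_le (R : Run G M y t P) (hG : IsPartition G) (hy : Feasible G y)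
    (W : Finset (Fin n)) (ht : 0 < t) (hmt : 12 * m ≤ t) {b : ℝ} (hb : 2 < b)
    (htb : 3072 * m * Real.log b ≤ t) {A B : ℝ}
    (hA : A = 4718592 * (m : ℝ) ^ 2 * Real.log b ^ 2) (hB : B = 4608 * (m : ℝ) ^ 2 / b ^ 16)
    {k : ℕ} (hk : r ≤ k) : ∫ ω, potential G W t A B (R.x k ω) ∂P ≤ Q G W y := by
  have hA0 : 0 ≤ A := by rw [hA]; positivity
  have hB0 : 0 ≤ B := by rw [hB]; positivity
  have hint : ∀ l, r ≤ l → Integrable (fun ω => potential G W t A B (R.x l ω)) P := fun l hl => by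
    refine Integrable.of_bound
      ((measurable_potential G W t A B).comp (R.measurable l)).aestronglyMeasurable (1 + B) ?_
    filter_upwards [R.ae_steady hG hy hl] with ω h
      using h.toFeasible.abs_potential_le ht hA0 hB0
  induction k, hk using Nat.le_induction with
  | base =>
    rw [← R.integral_Q_reduced hG hy W le_rfl]
    have hst := R.ae_steady hG hy le_rfl
    refine integral_mono_ae (hint r le_rfl) (Integrable.of_bound
      ((measurable_Q G W).comp (R.measurable r)).aestronglyMeasurable 1 ?_) ?_
    · filter_upwards [hst] with ω h
      rw [Real.norm_eq_abs, abs_of_nonneg h.toFeasible.Q_nonneg]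
      exact h.toFeasible.Q_le_one
    · filter_upwards [hst] with ω h
      have h1 := exp_neg_mul_invT_mem (t := t) hA0 (totalT G (R.x r ω))
      have h2 := mul_invT_mem ht hB0 (totalT G (R.x r ω))
      have h3 := mul_le_of_le_one_right (h.toFeasible.Q_nonneg (W := W)) h1.2
      unfold potential
      linarith [h2.1]
  | succ k hk ih =>
    refine le_trans ?_ ih
    have := R.integral_step_le hk hint (c := 0) (by
      rw [sub_zero]
      exact (R.iterate k hk).setIntegral_potential_le hG W ht hmt hb htb hA hB (R.adapted k)
        (R.measurable _) (R.ae_steady hG hy hk))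
    rwa [sub_zero] at this

theorem Run.integral_Q_le (R : Run G M y t P) (hG : IsPartition G) (hy : Feasible G y)
    (W : Finset (Fin n)) (ht : 0 < t) (hmt : 12 * m ≤ t) {b : ℝ} (hb : 2 < b)
    (htb : 3072 * m * Real.log b ≤ t) {A B : ℝ}
    (hA : A = 4718592 * (m : ℝ) ^ 2 * Real.log b ^ 2) (hB : B = 4608 * (m : ℝ) ^ 2 / b ^ 16)
    {k : ℕ} (hk : r ≤ k) :
    ∫ ω, Q G W (R.x k ω) ∂P ≤ Real.exp (A / t) * (Q G W y + B / t) := by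
  have hA0 : 0 ≤ A := by rw [hA]; positivity
  have hB0 : 0 ≤ B := by rw [hB]; positivity
  have hst := R.ae_steady hG hy hk
  have hQi : Integrable (fun ω => Q G W (R.x k ω)) P := by
    refine Integrable.of_bound
      ((measurable_Q G W).comp (R.measurable k)).aestronglyMeasurable 1 ?_
    filter_upwards [hst] with ω h
    rw [Real.norm_eq_abs, abs_of_nonneg h.toFeasible.Q_nonneg]
    exact h.toFeasible.Q_le_one
  have hpi : Integrable (fun ω => potential G W t A B (R.x k ω)) P := by
    refine Integrable.of_bound
      ((measurable_potential G W t A B).comp (R.measurable k)).aestronglyMeasurable (1 + B) ?_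
    filter_upwards [hst] with ω h using h.toFeasible.abs_potential_le ht hA0 hB0
  have h1 : ∫ ω, (Q G W (R.x k ω) * Real.exp (-(A / t)) - B / t) ∂P ≤
      ∫ ω, potential G W t A B (R.x k ω) ∂P := by
    refine integral_mono_ae ((hQi.mul_const _).sub (integrable_const _)) hpi ?_
    filter_upwards [hst] with ω h
    -- The cutoff at `t` is essential here: the last move may take `T` far below `t`, even to `0`,
    -- yet `invT` stays at most `1 / t`.
    have h2 := invT_le ht (totalT G (R.x k ω))
    have h3 := mul_le_mul_of_nonneg_left h2 hB0
    have h4 := mul_le_mul_of_nonneg_left h2 hA0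
    rw [mul_one_div] at h3 h4
    have h5 : Real.exp (-(A / t)) ≤ Real.exp (-A * invT t (totalT G (R.x k ω))) :=
      Real.exp_le_exp.2 (by linarith)
    have h6 := mul_le_mul_of_nonneg_left h5 (h.toFeasible.Q_nonneg (W := W))
    unfold potential
    linarith
  rw [integral_sub (hQi.mul_const _) (integrable_const _), integral_mul_const, integral_const,
    probReal_univ, one_smul] at h1
  have h2 := R.integral_potential_le hG hy W ht hmt hb htb hA hB hk
  have h3 : Real.exp (A / t) * Real.exp (-(A / t)) = 1 := by rw [← Real.exp_add]; simp
  calc ∫ ω, Q G W (R.x k ω) ∂P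
      = Real.exp (A / t) * ((∫ ω, Q G W (R.x k ω) ∂P) * Real.exp (-(A / t))) := by
        rw [mul_left_comm, h3, mul_one]
    _ ≤ Real.exp (A / t) * (Q G W y + B / t) :=
        mul_le_mul_of_nonneg_left (by linarith) (Real.exp_pos _).le

theorem Run.ae_terminates (R : Run G M y t P) (hG : IsPartition G) (hy : Feasible G y)
    (hmt : 12 * m ≤ t) : ∀ᵐ ω ∂P, R.Terminates ω := by
  have hm : Measurable fun z : Fin n → ℝ => (totalT G z : ℝ) :=
    (measurable_from_top (f := fun k : ℕ => (k : ℝ))).comp (measurable_totalT G)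
  have hint : ∀ l, r ≤ l → Integrable (fun ω => (totalT G (R.x l ω) : ℝ)) P := fun l _ => by
    refine Integrable.of_bound (hm.comp (R.measurable l)).aestronglyMeasurable (r * n) ?_
    filter_upwards with ω
    rw [Real.norm_eq_abs, abs_of_nonneg (Nat.cast_nonneg _)]
    exact_mod_cast totalT_le G _
  -- Every round is active on this event, so the mean of `T` falls by at least `q / 8` each time; as
  -- it is nonnegative and bounded at the start, `q = 0`.
  set q := P.real {ω | ¬ R.Terminates ω} with hq
  have hstep : ∀ k, r ≤ k → ∫ ω, (totalT G (R.x (k + 1) ω) : ℝ) ∂P ≤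
      ∫ ω, (totalT G (R.x k ω) : ℝ) ∂P - q / 8 := fun k hk => by
    refine R.integral_step_le (f := fun z => (totalT G z : ℝ)) hk hint ?_
    refine ((R.iterate k hk).setIntegral_totalT_le hG hmt (R.adapted k) (R.measurable _)
      (R.ae_steady hG hy hk)).trans ?_
    rw [integral_sub (hint k hk).integrableOn (integrable_const _), setIntegral_const]
    have hle : q ≤ P.real {ω | t < totalT G (R.x k ω)} := by
      refine measureReal_mono fun ω hω => ?_
      by_contra hcon
      exact hω ⟨k, hk, not_lt.1 hcon⟩
    rw [smul_eq_mul]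
    linarith
  have hsum : ∀ N : ℕ, N * (q / 8) ≤ r * n := fun N => by
    have h1 : ∫ ω, (totalT G (R.x (r + N) ω) : ℝ) ∂P ≤
        ∫ ω, (totalT G (R.x r ω) : ℝ) ∂P - N * (q / 8) := by
      induction N with
      | zero => simp
      | succ N ih =>
        have := hstep (r + N) (by omega)
        rw [← add_assoc]
        push_cast
        linarith
    have h2 : 0 ≤ ∫ ω, (totalT G (R.x (r + N) ω) : ℝ) ∂P :=
      integral_nonneg fun ω => Nat.cast_nonneg _
    have h3 : ∫ ω, (totalT G (R.x r ω) : ℝ) ∂P ≤ ∫ _ω, (r * n : ℝ) ∂P :=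
      integral_mono (hint r le_rfl) (integrable_const _) fun ω => by
        show (totalT G (R.x r ω) : ℝ) ≤ r * n
        exact_mod_cast totalT_le G _
    rw [integral_const, probReal_univ, one_smul] at h3
    linarith
  have hq0 : q = 0 := by
    by_contra hne
    have hpos : 0 < q / 8 := by
      have : 0 ≤ q := measureReal_nonneg
      positivity
    obtain ⟨N, hN⟩ := exists_nat_gt ((r * n : ℝ) / (q / 8))
    rw [div_lt_iff₀ hpos] at hN
    exact absurd (hsum N) (not_le.2 hN)
  rw [ae_iff]
  exact (measureReal_eq_zero_iff).1 hq0

theorem Run.tendsto_integral_Q (R : Run G M y t P) (hG : IsPartition G) (hy : Feasible G y)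
    (W : Finset (Fin n)) (hterm : ∀ᵐ ω ∂P, R.Terminates ω) :
    Integrable (fun ω => Q G W (R.output ω)) P ∧
      (∀ᵐ ω ∂P, Q G W (R.output ω) ≤ 1) ∧
      Filter.Tendsto (fun k => ∫ ω, Q G W (R.x (r + k) ω) ∂P) Filter.atTop
        (nhds (∫ ω, Q G W (R.output ω) ∂P)) := by
  have hmeas : ∀ k, AEStronglyMeasurable (fun ω => Q G W (R.x (r + k) ω)) P := fun k =>
    ((measurable_Q G W).comp (R.measurable _)).aestronglyMeasurable
  have hbd : ∀ k, ∀ᵐ ω ∂P, ‖Q G W (R.x (r + k) ω)‖ ≤ 1 := fun k => by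
    filter_upwards [R.ae_steady hG hy (Nat.le_add_right r k)] with ω h
    rw [Real.norm_eq_abs, abs_of_nonneg h.toFeasible.Q_nonneg]
    exact h.toFeasible.Q_le_one
  have hev := R.ae_eventually_eq_output hterm
  have hlim : ∀ᵐ ω ∂P, Filter.Tendsto (fun k => Q G W (R.x (r + k) ω)) Filter.atTop
      (nhds (Q G W (R.output ω))) := by
    filter_upwards [hev] with ω h
    refine tendsto_const_nhds.congr' ?_
    filter_upwards [(Filter.tendsto_add_atTop_nat r).eventually h] with k hk
    rw [add_comm, hk]
  have hbd' : ∀ᵐ ω ∂P, ‖Q G W (R.output ω)‖ ≤ 1 := by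
    filter_upwards [hlim, ae_all_iff.2 hbd] with ω h1 h2
    exact le_of_tendsto h1.norm (Filter.Eventually.of_forall h2)
  refine ⟨Integrable.of_bound (aestronglyMeasurable_of_tendsto_ae _ hmeas hlim) 1 hbd',
    hbd'.mono fun ω h => (le_abs_self _).trans h, ?_⟩
  exact tendsto_integral_of_dominated_convergence (fun _ => 1) hmeas (integrable_const _) hbd hlim

end Run

/-! ### Absorbing the constants and conclusion -/

/-- The bound exceeds one if the threshold is small. -/
theorem one_le_exp_mul_of_small {m t : ℕ} {a b : ℝ} (ht : 0 < t) (hb : 2 < b)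
    (ha : a = (m : ℝ) ^ 2 * Real.log b ^ 3 / t) (hsmall : (t : ℝ) < 3072 * m * Real.log b) :
    1 ≤ Real.exp (10000000 * a) * (a / b) := by
  have ht' : (0 : ℝ) < t := by exact_mod_cast ht
  have hl2 : 0.69 ≤ Real.log b :=
    (by linarith [Real.log_two_gt_d9] : (0.69 : ℝ) ≤ Real.log 2).trans
      (Real.log_le_log two_pos hb.le)
  have hm : 1 ≤ m := by
    by_contra h
    have : m = 0 := by omega
    rw [this] at hsmall
    simp only [Nat.cast_zero, mul_zero, zero_mul] at hsmall
    linarith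
  have hm' : (1 : ℝ) ≤ m := by exact_mod_cast hm
  have hlb : 0 < Real.log b := by linarith
  -- Small `t` makes `a` at least of order `log^2 b`, so `exp (C a)` exceeds any fixed power of `b`;
  -- `b^15` suffices to offset both `1 / b` and the smallness of `a`.
  have ha1 : Real.log b ^ 2 / 3072 ≤ a := by
    rw [ha, div_le_div_iff₀ (by norm_num) ht']
    have h1 : Real.log b ^ 2 * t ≤ Real.log b ^ 2 * (3072 * m * Real.log b) :=
      mul_le_mul_of_nonneg_left hsmall.le (by positivity)
    have h2 : (m : ℝ) * Real.log b ^ 3 ≤ m ^ 2 * Real.log b ^ 3 :=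
      mul_le_mul_of_nonneg_right (by nlinarith) (by positivity)
    linarith
  have hb15 : b ^ 15 ≤ Real.exp (10000000 * a) := by
    have e : b ^ 15 = Real.exp (15 * Real.log b) := by
      rw [show (15 : ℝ) = (15 : ℕ) by norm_num, Real.exp_nat_mul, Real.exp_log (by linarith)]
    rw [e]
    apply Real.exp_le_exp.2
    nlinarith
  have hb14 : (2 : ℝ) ^ 14 ≤ b ^ 14 := pow_le_pow_left₀ zero_le_two hb.le 14
  have ha2 : 1 / 8192 ≤ a := by nlinarith
  have hb0 : 0 < b := by linarith
  calc (1 : ℝ) ≤ 2 ^ 14 * (1 / 8192) := by norm_num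
    _ ≤ b ^ 14 * a := by gcongr
    _ = b ^ 15 * (a / b) := by field_simp
    _ ≤ _ := by gcongr

/-- `A` has one logarithm fewer than `a * t`; `log b ≥ 0.69` makes up for it within the constant. In
the additive term the spare `b^15` covers `4608`. -/
theorem exp_mul_add_le {m t : ℕ} {a b q : ℝ} (ht : 0 < t) (hb : 2 < b) (hq : 0 ≤ q)
    (ha : a = (m : ℝ) ^ 2 * Real.log b ^ 3 / t) :
    Real.exp (4718592 * (m : ℝ) ^ 2 * Real.log b ^ 2 / t) *
        (q + 4608 * (m : ℝ) ^ 2 / b ^ 16 / t) ≤ Real.exp (10000000 * a) * (q + a / b) := by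
  have ht' : (0 : ℝ) < t := by exact_mod_cast ht
  have hl2 : 0.69 ≤ Real.log b :=
    (by linarith [Real.log_two_gt_d9] : (0.69 : ℝ) ≤ Real.log 2).trans
      (Real.log_le_log two_pos hb.le)
  have hb0 : 0 < b := by linarith
  have h1 : 4718592 * (m : ℝ) ^ 2 * Real.log b ^ 2 / t ≤ 10000000 * a := by
    rw [ha, ← mul_div_assoc]
    apply div_le_div_of_nonneg_right _ ht'.le
    have : 0 ≤ (m : ℝ) ^ 2 * Real.log b ^ 2 := by positivity
    nlinarith
  have h2 : 4608 * (m : ℝ) ^ 2 / b ^ 16 / t ≤ a / b := by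
    have hb15 : (2 : ℝ) ^ 15 ≤ b ^ 15 := pow_le_pow_left₀ zero_le_two hb.le 15
    have hl3 : (0.69 : ℝ) ^ 3 ≤ Real.log b ^ 3 := pow_le_pow_left₀ (by norm_num) hl2 3
    have h3 : 4608 ≤ Real.log b ^ 3 * b ^ 15 :=
      le_trans (by norm_num) (mul_le_mul hl3 hb15 (by norm_num) (by positivity))
    rw [ha, div_div, div_div, div_le_div_iff₀ (by positivity) (by positivity)]
    calc 4608 * (m : ℝ) ^ 2 * (t * b) = 4608 * (m ^ 2 * (t * b)) := by ring
      _ ≤ Real.log b ^ 3 * b ^ 15 * (m ^ 2 * (t * b)) := by gcongr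
      _ = m ^ 2 * Real.log b ^ 3 * (b ^ 16 * t) := by ring
  have : 0 ≤ 4608 * (m : ℝ) ^ 2 / b ^ 16 / t := by positivity
  gcongr

end KPR

theorem mainTheorem10 :
    ∃ C : ℝ, 0 < C ∧
      ∀ (n r m t : ℕ) (G : Fin r → Finset (Fin n)) (M : Matrix (Fin m) (Fin n) ℝ)
        (y : Fin n → ℝ) (W : Finset (Fin n)) (a b : ℝ),
        KPR.IsPartition G →
        (∀ k j, 0 ≤ M k j) →
        (∀ j, y j ∈ Set.Icc (0 : ℝ) 1) →
        (∀ i, ∑ j ∈ G i, y j = 1) →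
        0 < t → 12 * m ≤ t →
        2 < b → a = (m : ℝ) ^ 2 * Real.log b ^ 3 / t →
        ∀ (Ω : Type*) [MeasurableSpace Ω] (P : Measure Ω) [IsProbabilityMeasure P]
          (R : KPR.Run G M y t P),
          (∀ᵐ ω ∂P, R.Terminates ω) ∧
          Integrable (fun ω => KPR.Q G W (R.output ω)) P ∧
          ∫ ω, KPR.Q G W (R.output ω) ∂P ≤ Real.exp (C * a) * (KPR.Q G W y + a / b) := by
  refine ⟨10000000, by norm_num, ?_⟩
  intro n r m t G M y W a b hG _ hy01 hyG ht hmt hb ha Ω _ P _ R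
  have hy : KPR.Feasible G y := ⟨hy01, hyG⟩
  have hterm := R.ae_terminates hG hy hmt
  obtain ⟨hint, hle, hlim⟩ := R.tendsto_integral_Q hG hy W hterm
  refine ⟨hterm, hint, ?_⟩
  rcases lt_or_ge (t : ℝ) (3072 * m * Real.log b) with hsmall | hlarge
  · have h1 : ∫ ω, KPR.Q G W (R.output ω) ∂P ≤ 1 := by
      have := integral_mono_ae hint (integrable_const (1 : ℝ)) hle
      simpa using this
    have h2 := KPR.one_le_exp_mul_of_small ht hb ha hsmall
    have h3 : 0 ≤ Real.exp (10000000 * a) * KPR.Q G W y :=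
      mul_nonneg (Real.exp_pos _).le hy.Q_nonneg
    linarith
  · refine le_trans (le_of_tendsto hlim (Filter.Eventually.of_forall fun k => ?_))
      (KPR.exp_mul_add_le ht hb hy.Q_nonneg ha)
    exact R.integral_Q_le hG hy W ht hmt hb hlarge rfl rfl (Nat.le_add_right r k)
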